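/- Let $f\in C^1[0,\infty)$ with $f>0$ on $[0,\infty)$, put $g=\log f$ and $H=\dfrac{g\,g''}{(g')^2}$, and let $q\neq 0$ be a real number. Assume (G1) $g(s)>0$ for all large $s$, $\displaystyle\int_s^\infty\frac{du}{g(u)}<\infty$ for all large $s$, and $\displaystyle\lim_{s\to\infty}H(s)=\frac1q$; (G2) there are $C>0$ and $s_0>0$ such that $g\in C^5(s_0,\infty)$ and $|H^{(k)}(s)|<C\left(\dfrac{g'(s)}{g(s)}\right)^{k}$ for all $k\in\{1,2,3\}$ and $s>s_0$. (Under these assumptions, for every large $\rho$ there is exactly one $s\ge 0$ with $g(s)=\rho$; it is denoted $g^{-1}(\rho)$.) Then for every $\varepsilon\in(0,\tfrac12]$ there are $r_0>0$ and a function $U_\infty\in C^2((0,r_0])$ such that $u(x)=U_\infty(|x|)$ solves $-\Delta u=f(u)$ in $\{x\in\mathbb R^2:0<|x|<r_0\}$, $U_\infty(r)\to\infty$ as $r\to0^+$, $$g(U_\infty(r))=-2\log r-2\log(-2\log r)+\log\!\left[\frac{g}{g'}\big(g^{-1}(-2\log r)\big)\right]+\log 4-\log q+\log\!\Big(qH\big(g^{-1}(-2\log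 r)\big)\Big)+o\big((-\log r)^{-1+\varepsilon}\big)\quad\text{as } r\to0^+,$$ $U_\infty>0$ on $(0,r_0)$, and $U_\infty(r_0)=0$. Moreover, $U_\infty$ extends to all $r>0$ as a radial singular solution in the following sense: for every locally Lipschitz $F:\mathbb R\to\mathbb R$ with $F=f$ on $[0,\infty)$ and $F(s)\le A(1+|s|)$ for all $s<0$ with some constant $A$ (for instance $F(s)=f(\max\{s,0\})$), there is $V\in C^2(0,\infty)$ with $V=U_\infty$ on $(0,r_0]$ such that $v(x)=V(|x|)$ solves $-\Delta v=F(v)$ in $\mathbb R^2\setminus\{0\}$. -/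

import Mathlib

open Set Filter Topology MeasureTheory Asymptotics

noncomputable section

/-- `H[g] = g g'' / (g')²`. -/
def HQuot (g : ℝ → ℝ) (s : ℝ) : ℝ :=
  g s * iteratedDeriv 2 g s / (deriv g s) ^ 2

/-- Condition (G1): `g > 0` near infinity, `∫_s^∞ du / g(u) < ∞` for all large `s`, and
`H[g](s) → 1/q` as `s → ∞` (it is used with a real `q ≠ 0` only). -/
def CondG1 (g : ℝ → ℝ) (q : ℝ) : Prop :=
  (∀ᶠ s in atTop, 0 < g s) ∧
  (∀ᶠ s in atTop, IntegrableOn (fun u => 1 / g u) (Ioi s)) ∧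
  Tendsto (HQuot g) atTop (𝓝 (1 / q))

/-- Condition (G2): for some `C, s₀ > 0`, `g ∈ C⁵(s₀, ∞)` and `|H⁽ᵏ⁾| < C (g'/g)ᵏ` on `(s₀, ∞)`
for `k = 1, 2, 3`. -/
def CondG2 (g : ℝ → ℝ) : Prop :=
  ∃ C > 0, ∃ s₀ > 0, ContDiffOn ℝ 5 g (Ioi s₀) ∧
    ∀ k ∈ Finset.Icc 1 3, ∀ s > s₀,
      |iteratedDeriv k (HQuot g) s| < C * (deriv g s / g s) ^ k

/-- The inverse function of `g : [0, ∞) → ℝ`. If `g` is continuous on `[0, ∞)`, tends to infinity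
and is strictly increasing near infinity, then for every large `ρ` this is the unique `s ≥ 0`
with `g s = ρ`. -/
def gInv (g : ℝ → ℝ) : ℝ → ℝ :=
  Function.invFunOn g (Ici 0)

/-- `u(x) = U(|x|)` is of class `C²` in `r = |x|` on the open set `I ⊆ (0, ∞)` of radii and solves
`-Δu = f(u)` at all points `x` of the plane with `|x| ∈ I`. -/
def IsRadialSolutionOn (f U : ℝ → ℝ) (I : Set ℝ) : Prop :=
  ContDiffOn ℝ 2 U I ∧
  ∀ x : EuclideanSpace ℝ (Fin 2), ‖x‖ ∈ I →
    -(Laplacian.laplacian (fun y : EuclideanSpace ℝ (Fin 2) => U ‖y‖) x) = f (U ‖x‖)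

/-- `U` is a radial singular solution of `-Δu = f(u)` in the plane: it is `C²` on `(0, ∞)`, solves
the equation except at `x = 0`, and `U(r) → ∞` as `r → 0`. -/
def IsRadialSingularSolution (f U : ℝ → ℝ) : Prop :=
  IsRadialSolutionOn f U (Ioi 0) ∧ Tendsto U (𝓝[>] 0) atTop

/-- `F : ℝ → ℝ` extends `f : [0, ∞) → ℝ` in an admissible way: it is locally Lipschitz, agrees with
`f` on `[0, ∞)`, and on the negative axis it has at most linear growth from above. (Without
any such bound solutions may blow up to `-∞` at a finite radius after their zero.) The
constant extension `s ↦ f (max s 0)` of a `C¹` function is an example. -/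
def IsAdmissibleExtension (f F : ℝ → ℝ) : Prop :=
  LocallyLipschitz F ∧ EqOn F f (Ici 0) ∧ ∃ A : ℝ, ∀ s < 0, F s ≤ A * (1 + |s|)

end

/-!
Radial solutions of `-Δu = exp (g(u))` in the plane solve `u'' = -exp (g(u) - ρ) / 4` in the
variable `ρ = -2 log r`, and the singularity sits at `ρ = ∞`. With `w = g(u)`, `h(w) = H(g⁻¹(w))`
and `θ(w) = log (w g'(g⁻¹(w)) / (4 h(w)))` this becomes `w'' = (h / w) (w' ^ 2 - exp (w - ρ +
θ(w)))`, and the claimed expansion is `w = ρ - θ(ρ) + o(ρ ^ (-1 + ε))`. The proof gives the error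
`O(log ρ / ρ)`.

The key is to use `w` as the independent variable. For `z = log (dw / dρ)` and
`v = (w - ρ + θ(w)) - 2 z` the equation is the planar system
`z' = -(h / w) (exp v - 1)`, `v' = 1 + θ' - exp (-z) + 2 (h / w) (exp v - 1)`.
The bounds (G2) say that the derivatives of `h` in the variable `log w`, up to the third, are
bounded (`LogProfile`). Hence the equilibrium `(z₀, v₀)`, frozen at `w` with a first correction,
moves slowly: in `Z = z - z₀`, `N = v - v₀` the system is
`Z' = -c (exp N - 1)`, `N' = b (1 - exp (-Z)) + 2 c (exp N - 1) + m` with `m = O(w⁻²)`.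
The energy `(exp N - 1 - N) + (b / c) (exp (-Z) - 1 + Z)` has no cross terms in its derivative, and
the remaining quadratic terms are nonnegative, because `(b / c)' → q > 0`. This limit needs
`w h' → 0`, which follows from the convergence of `h` and the bound on its second logarithmic
derivative (`tendsto_zero_of_log_deriv`). So solutions that vanish at a late `w = n` satisfy
`Z, N = O(1 / w)` uniformly in `n`, and a limit `n → ∞` exists by compactness of the initial
values (`exists_decaying_solution`). Undoing the substitutions gives the singular solution near
`r = 0` (`LogProfile.exists_singular_solution`).

Away from the singularity, in `t = 2 log r`, the energy `2 exp (-t) u' ^ 2 + ∫ F` decreases. With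
the one-sided growth bound of an admissible `F` it bounds `u'` linearly in `u`, so that solutions
continue to all `r > 0` (`exists_radial_continuation`). For the extension of `f` by a constant the
solution is decreasing and concave in `t`, so it has a first zero, which defines `r₀`.
-/

/-! ### Ordinary differential equations on half lines -/

open scoped NNReal in
/-- The time-dependent vector field `v` is Lipschitz in space, uniformly over bounded time intervals
and bounded sets of space. -/
def LipschitzOnBounded {E : Type*} [NormedAddCommGroup E] (v : ℝ → E → E) : Prop :=
  ∀ a b R : ℝ, ∃ K : ℝ≥0, ∀ t ∈ Icc a b, LipschitzOnWith K (v t) (Metric.closedBall 0 R)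

section ODE

variable {E : Type*} [NormedAddCommGroup E] [NormedSpace ℝ E] {v : ℝ → E → E}

theorem IsIntegralCurveOn.hasDerivWithinAt_Ici {y : ℝ → E} {a b t : ℝ}
    (hy : IsIntegralCurveOn y v (Icc a b)) (ht : t ∈ Ico a b) :
    HasDerivWithinAt y (v t (y t)) (Ici t) t :=
  (hy t (Ico_subset_Icc_self ht)).mono_of_mem_nhdsWithin (Icc_mem_nhdsGE_of_mem ht)

theorem IsIntegralCurveOn.eqOn_Icc (hv : LipschitzOnBounded v) {y₁ y₂ : ℝ → E} {a b : ℝ}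
    (h₁ : IsIntegralCurveOn y₁ v (Icc a b)) (h₂ : IsIntegralCurveOn y₂ v (Icc a b))
    (h : y₁ a = y₂ a) : EqOn y₁ y₂ (Icc a b) := by
  obtain ⟨R₁, hR₁⟩ := isCompact_Icc.exists_bound_of_continuousOn h₁.continuousOn
  obtain ⟨R₂, hR₂⟩ := isCompact_Icc.exists_bound_of_continuousOn h₂.continuousOn
  obtain ⟨K, hK⟩ := hv a b (max R₁ R₂)
  refine ODE_solution_unique_of_mem_Icc_right (K := K) (v := v)
    (s := fun _ => Metric.closedBall 0 (max R₁ R₂))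
    (fun t ht => hK t (Ico_subset_Icc_self ht)) h₁.continuousOn
    (fun t ht => h₁.hasDerivWithinAt_Ici ht) (fun t ht => ?_) h₂.continuousOn
    (fun t ht => h₂.hasDerivWithinAt_Ici ht) (fun t ht => ?_) h
  · simpa using Or.inl (hR₁ t (Ico_subset_Icc_self ht))
  · simpa using Or.inr (hR₂ t (Ico_subset_Icc_self ht))

/-- Solutions of an initial value problem on all compact intervals `[a, b]` patch together to a
solution on `[a, ∞)`, by uniqueness. -/
theorem exists_isIntegralCurveOn_Ici (hv : LipschitzOnBounded v) {a : ℝ} {x : E}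
    (h : ∀ b, a ≤ b → ∃ y : ℝ → E, y a = x ∧ IsIntegralCurveOn y v (Icc a b)) :
    ∃ y : ℝ → E, y a = x ∧ IsIntegralCurveOn y v (Ici a) := by
  have h' : ∀ n : ℕ, ∃ y : ℝ → E, y a = x ∧ IsIntegralCurveOn y v (Icc a (a + n)) :=
    fun n => h _ (by linarith [n.cast_nonneg (α := ℝ)])
  choose Y hYa hY using h'
  have key : ∀ (n m : ℕ), n ≤ m → EqOn (Y n) (Y m) (Icc a (a + n)) := fun n m hnm =>
    (hY n).eqOn_Icc hv ((hY m).mono (Icc_subset_Icc_right (by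
      have : (n : ℝ) ≤ m := by exact_mod_cast hnm
      linarith))) (by rw [hYa, hYa])
  set y : ℝ → E := fun t => Y (⌈t - a⌉₊ + 1) t with hy
  have hyY : ∀ n : ℕ, ∀ t ∈ Icc a (a + n), y t = Y n t := by
    intro n t ht
    have h1 : t ≤ a + (⌈t - a⌉₊ + 1 : ℕ) := by
      have := Nat.le_ceil (t - a)
      push_cast
      linarith
    rcases le_total n (⌈t - a⌉₊ + 1) with hn | hn
    · exact (key _ _ hn ht).symm
    · exact key _ _ hn ⟨ht.1, h1⟩
  refine ⟨y, by rw [hy]; exact hYa _, fun t ht => ?_⟩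
  obtain ⟨n, hn⟩ := exists_nat_gt (t - a)
  have htn : t ∈ Icc a (a + n) := ⟨ht, by linarith⟩
  have h1 : HasDerivWithinAt y (v t (Y n t)) (Icc a (a + n)) t :=
    (hY n t htn).congr (hyY n) (hyY n t htn)
  rw [← hyY n t htn] at h1
  refine h1.mono_of_mem_nhdsWithin ?_
  have : Icc a (a + n) = Ici a ∩ Iic (a + n) := rfl
  rw [this]
  exact inter_mem self_mem_nhdsWithin (mem_nhdsWithin_of_mem_nhds (Iic_mem_nhds (by linarith)))

open scoped NNReal in
/-- A bounded, globally Lipschitz vector field has integral curves on any compact interval, through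
any point at any time. -/
theorem exists_isIntegralCurveOn_Icc_of_bounded [CompleteSpace E] {a b t₀ : ℝ} {K : ℝ≥0} {C : ℝ}
    (ht₀ : t₀ ∈ Icc a b) (hK : ∀ t ∈ Icc a b, LipschitzWith K (v t))
    (hC : ∀ t ∈ Icc a b, ∀ y, ‖v t y‖ ≤ C)
    (hcont : ∀ y, ContinuousOn (fun t => v t y) (Icc a b)) (x : E) :
    ∃ y : ℝ → E, y t₀ = x ∧ IsIntegralCurveOn y v (Icc a b) := by
  have hab : a ≤ b := ht₀.1.trans ht₀.2
  have hC0 : 0 ≤ C := (norm_nonneg _).trans (hC t₀ ht₀ x)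
  have hPL : IsPicardLindelof v (⟨t₀, ht₀⟩ : Icc a b) x
      (⟨C * (b - a), mul_nonneg hC0 (by linarith)⟩ : ℝ≥0) 0 ⟨C, hC0⟩ K :=
    { lipschitzOnWith := fun t ht => (hK t ht).lipschitzOnWith
      continuousOn := fun y _ => hcont y
      norm_le := fun t ht y _ => hC t ht y
      mul_max_le := by
        have : max (b - t₀) (t₀ - a) ≤ b - a := max_le (by linarith [ht₀.1]) (by linarith [ht₀.2])
        rw [NNReal.coe_zero, sub_zero]
        exact mul_le_mul_of_nonneg_left this hC0 }
  exact hPL.exists_eq_forall_mem_Icc_hasDerivWithinAt₀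

/-- Compactness: if a bounded Lipschitz vector field has integral curves on `[a, a + n]` that obey a
bound `B` which does not depend on `n`, then it has one on `[a, ∞)` that obeys the same bound. -/
theorem exists_isIntegralCurveOn_Ici_of_bound [ProperSpace E] {a : ℝ} {B : ℝ → ℝ}
    (hK : ∀ b, ∃ K : NNReal, ∀ t ∈ Icc a b, LipschitzWith K (v t))
    (hC : ∀ b, ∃ C : ℝ, ∀ t ∈ Icc a b, ∀ y, ‖v t y‖ ≤ C)
    (hcont : ∀ y, ContinuousOn (fun t => v t y) (Ici a))
    (h : ∀ n : ℕ, ∃ y : ℝ → E, IsIntegralCurveOn y v (Icc a (a + n)) ∧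
      ∀ t ∈ Icc a (a + n), ‖y t‖ ≤ B t) :
    ∃ y : ℝ → E, IsIntegralCurveOn y v (Ici a) ∧ ∀ t ∈ Ici a, ‖y t‖ ≤ B t := by
  choose Y hY hYB using h
  have hmem : ∀ n, Y n a ∈ Metric.closedBall (0 : E) (B a) := fun n => by
    simpa using hYB n a ⟨le_rfl, by simp⟩
  obtain ⟨x, -, φ, hφ, hx⟩ := (isCompact_closedBall (0 : E) (B a)).tendsto_subseq hmem
  -- The field is modified before time `a`, so that it is locally Lipschitz at all times.
  set v' : ℝ → E → E := fun t => v (max a t) with hv'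
  have hvv' : ∀ t, a ≤ t → v' t = v t := fun t ht => by simp [hv', max_eq_right ht]
  have hLip : LipschitzOnBounded v' := by
    intro c b R
    obtain ⟨K, hK⟩ := hK (max a b)
    exact ⟨K, fun t ht => (hK _ ⟨le_max_left _ _, max_le_max le_rfl ht.2⟩).lipschitzOnWith⟩
  have hcongr : ∀ (y : ℝ → E) (s : Set ℝ), s ⊆ Ici a →
      (IsIntegralCurveOn y v' s ↔ IsIntegralCurveOn y v s) := by
    intro y s hs
    refine forall₂_congr fun t ht => ?_
    rw [hvv' t (hs ht)]
  obtain ⟨y, hya, hy⟩ := exists_isIntegralCurveOn_Ici (a := a) (x := x) hLip (fun b hb => by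
    obtain ⟨K, hK⟩ := hK b
    obtain ⟨C, hC⟩ := hC b
    obtain ⟨y, h1, h2⟩ := exists_isIntegralCurveOn_Icc_of_bounded (v := v) (left_mem_Icc.2 hb)
      hK hC (fun y => (hcont y).mono Icc_subset_Ici_self) x
    exact ⟨y, h1, (hcongr y _ Icc_subset_Ici_self).2 h2⟩)
  rw [hcongr y _ subset_rfl] at hy
  refine ⟨y, hy, fun t ht => ?_⟩
  obtain ⟨N, hN⟩ := exists_nat_gt (t - a)
  obtain ⟨K, hK⟩ := hK t
  -- Continuous dependence on the initial value carries the bound to the limit.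
  have hlim : Tendsto (fun n => Y (φ n) t) atTop (𝓝 (y t)) := by
    rw [tendsto_iff_dist_tendsto_zero]
    have h0 : Tendsto (fun n => dist (Y (φ n) a) x * Real.exp (K * (t - a))) atTop (𝓝 0) := by
      simpa using (tendsto_iff_dist_tendsto_zero.1 hx).mul_const (Real.exp (K * (t - a)))
    refine squeeze_zero' (Eventually.of_forall fun _ => dist_nonneg) ?_ h0
    filter_upwards [eventually_ge_atTop N] with n hn
    have hnφ : t ≤ a + (φ n : ℕ) := by
      have : (N : ℝ) ≤ (φ n : ℕ) := by exact_mod_cast hn.trans (hφ.id_le n)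
      linarith
    have h1 : IsIntegralCurveOn (Y (φ n)) v (Icc a t) :=
      (hY (φ n)).mono (Icc_subset_Icc_right hnφ)
    have h2 : IsIntegralCurveOn y v (Icc a t) := hy.mono Icc_subset_Ici_self
    refine dist_le_of_trajectories_ODE_of_mem (K := K) (v := v) (s := fun _ => univ)
      (fun s hs => (hK s (Ico_subset_Icc_self hs)).lipschitzOnWith) h1.continuousOn
      (fun s hs => h1.hasDerivWithinAt_Ici hs) (fun _ _ => trivial) h2.continuousOn
      (fun s hs => h2.hasDerivWithinAt_Ici hs) (fun _ _ => trivial) (by rw [hya]) t ⟨ht, le_rfl⟩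
  refine le_of_tendsto hlim.norm ?_
  filter_upwards [eventually_ge_atTop N] with n hn
  refine hYB (φ n) t ⟨ht, ?_⟩
  have : (N : ℝ) ≤ (φ n : ℕ) := by exact_mod_cast hn.trans (hφ.id_le n)
  linarith

/-- Two solutions of a scalar equation that meet at `a` combine to one across `a`. -/
theorem hasDerivAt_ite_le {y₁ y₂ : ℝ → ℝ} {d : ℝ → ℝ} {a : ℝ}
    (h₁ : ∀ t ≤ a, HasDerivWithinAt y₁ (d t) (Iic a) t)
    (h₂ : ∀ t, a ≤ t → HasDerivWithinAt y₂ (d t) (Ici a) t) (h : y₁ a = y₂ a) (t : ℝ) :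
    HasDerivAt (fun t => if t ≤ a then y₁ t else y₂ t) (d t) t := by
  have e₂ : EqOn (fun t => if t ≤ a then y₁ t else y₂ t) y₂ (Ici a) := by
    intro s hs
    rcases eq_or_lt_of_le (show a ≤ s from hs) with rfl | hs'
    · simp [h]
    · simp [not_le.2 hs']
  have e₁ : EqOn (fun t => if t ≤ a then y₁ t else y₂ t) y₁ (Iic a) := by
    intro s hs
    simp [show s ≤ a from hs]
  rcases lt_trichotomy t a with ht | rfl | ht
  · exact ((h₁ t ht.le).congr_of_mem e₁ ht.le).hasDerivAt (Iic_mem_nhds ht)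
  · have := ((h₁ t le_rfl).congr_of_mem e₁ self_mem_Iic).union
      ((h₂ t le_rfl).congr_of_mem e₂ self_mem_Ici)
    rwa [Iic_union_Ici, hasDerivWithinAt_univ] at this
  · exact ((h₂ t ht.le).congr_of_mem e₂ ht.le).hasDerivAt (Ici_mem_nhds ht)

end ODE

/-! ### A perturbed Hamiltonian system -/

/-- The projection of the real line to `[-1, 1]`. -/
def unitClamp (x : ℝ) : ℝ := max (-1) (min x 1)

theorem unitClamp_mem (x : ℝ) : unitClamp x ∈ Icc (-1 : ℝ) 1 := by
  unfold unitClamp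
  exact ⟨le_max_left _ _, max_le (by norm_num) (min_le_right _ _)⟩

theorem unitClamp_neg (x : ℝ) : unitClamp (-x) = -unitClamp x := by
  unfold unitClamp
  grind

theorem unitClamp_eq_self_of_abs_lt {x : ℝ} (h : |unitClamp x| < 1) : unitClamp x = x := by
  unfold unitClamp at *
  grind

theorem lipschitzWith_unitClamp : LipschitzWith 1 unitClamp :=
  (LipschitzWith.id.min_const 1).const_max (-1)

/-- The function `exp x - 1`, frozen outside of `[-1, 1]`. -/
noncomputable def clampedExpSubOne (x : ℝ) : ℝ := Real.exp (unitClamp x) - 1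

theorem exp_le_three_of_mem {x : ℝ} (hx : x ∈ Icc (-1 : ℝ) 1) : Real.exp x ≤ 3 :=
  (Real.exp_le_exp.2 hx.2).trans (by linarith [Real.exp_one_lt_d9])

theorem lipschitzWith_clampedExpSubOne : LipschitzWith 3 clampedExpSubOne := by
  have h : LipschitzOnWith 3 (fun x => Real.exp x - 1) (Icc (-1 : ℝ) 1) := by
    refine (convex_Icc _ _).lipschitzOnWith_of_nnnorm_hasDerivWithin_le
      (f' := Real.exp) (fun x _ => ((Real.hasDerivAt_exp x).sub_const 1).hasDerivWithinAt) ?_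
    intro x hx
    rw [← NNReal.coe_le_coe]
    simpa using exp_le_three_of_mem hx
  have h2 : LipschitzWith (3 * 1) (fun x => Real.exp (unitClamp x) - 1) := by
    intro x y
    refine (h (unitClamp_mem x) (unitClamp_mem y)).trans ?_
    have := lipschitzWith_unitClamp x y
    rw [mul_one]
    gcongr
    simpa using this
  rw [mul_one] at h2
  exact h2

theorem abs_clampedExpSubOne_le (x : ℝ) : |clampedExpSubOne x| ≤ 2 * |unitClamp x| := by
  have h := unitClamp_mem x
  unfold clampedExpSubOne
  exact Real.abs_exp_sub_one_le (abs_le.2 h)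

theorem abs_clampedExpSubOne_le_two (x : ℝ) : |clampedExpSubOne x| ≤ 2 := by
  have := abs_le.2 (unitClamp_mem x)
  linarith [abs_clampedExpSubOne_le x]

theorem half_unitClamp_le_clampedExpSubOne {x : ℝ} (hx : 0 ≤ x) :
    unitClamp x / 2 ≤ clampedExpSubOne x := by
  have h : 0 ≤ unitClamp x := by unfold unitClamp; exact le_max_of_le_right (by positivity)
  unfold clampedExpSubOne
  linarith [Real.add_one_le_exp (unitClamp x)]

theorem clampedExpSubOne_le_half_unitClamp {x : ℝ} (hx : x ≤ 0) :
    clampedExpSubOne x ≤ unitClamp x / 2 := by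
  have h : unitClamp x ≤ 0 := by unfold unitClamp; grind
  have h' := (unitClamp_mem x).1
  unfold clampedExpSubOne
  set c := unitClamp x
  -- `exp c ≤ 1 / (1 - c) ≤ 1 + c / 2` for `-1 ≤ c ≤ 0`
  have h1 : 1 - c ≤ Real.exp (-c) := by linarith [Real.add_one_le_exp (-c)]
  have h2 : Real.exp c * Real.exp (-c) = 1 := by rw [← Real.exp_add]; simp
  have h3 : Real.exp c * (1 - c) ≤ 1 := by
    exact (mul_le_mul_of_nonneg_left h1 (Real.exp_pos c).le).trans h2.le
  nlinarith [Real.exp_pos c]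

/-- The primitive of `clampedExpSubOne`: it equals `exp x - 1 - x` on `[-1, 1]` and grows linearly
outside. -/
noncomputable def clampedExpPotential (x : ℝ) : ℝ := ∫ t in (0 : ℝ)..x, clampedExpSubOne t

theorem hasDerivAt_clampedExpPotential (x : ℝ) :
    HasDerivAt clampedExpPotential (clampedExpSubOne x) x :=
  lipschitzWith_clampedExpSubOne.continuous.integral_hasStrictDerivAt 0 x |>.hasDerivAt

theorem clampedExpPotential_zero : clampedExpPotential 0 = 0 := by simp [clampedExpPotential]

theorem unitClamp_sq_le (x : ℝ) : unitClamp x ^ 2 ≤ 8 * clampedExpPotential x := by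
  have hc : Continuous clampedExpPotential :=
    continuous_iff_continuousAt.2 fun x => (hasDerivAt_clampedExpPotential x).continuousAt
  rcases le_total 0 x with hx | hx
  · have hmono : MonotoneOn clampedExpPotential (Ici 0) := by
      refine monotoneOn_of_hasDerivWithinAt_nonneg (convex_Ici 0) hc.continuousOn
        (fun x _ => (hasDerivAt_clampedExpPotential x).hasDerivWithinAt) fun x hx => ?_
      have hx : (0 : ℝ) < x := by simpa using hx
      have := half_unitClamp_le_clampedExpSubOne hx.le
      have h : 0 ≤ unitClamp x := by unfold unitClamp; exact le_max_of_le_right (by positivity)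
      linarith
    have hy0 : 0 ≤ unitClamp x := by unfold unitClamp; exact le_max_of_le_right (by positivity)
    have hy1 := (unitClamp_mem x).2
    have hyx : unitClamp x ≤ x := by unfold unitClamp; grind
    have h1 := hmono hy0 hx hyx
    have h2 : MonotoneOn (fun t => clampedExpPotential t - t ^ 2 / 4) (Icc 0 1) := by
      refine monotoneOn_of_hasDerivWithinAt_nonneg (f' := fun t => clampedExpSubOne t - t / 2)
        (convex_Icc 0 1) (by fun_prop) (fun t _ => HasDerivAt.hasDerivWithinAt ?_) fun t ht => ?_
      · have := (hasDerivAt_clampedExpPotential t).sub ((hasDerivAt_pow 2 t).div_const 4)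
        convert! this using 1
        simp; ring
      · have ht : t ∈ Ioo (0 : ℝ) 1 := by simpa using ht
        have h : unitClamp t = t := by unfold unitClamp; grind
        have := half_unitClamp_le_clampedExpSubOne ht.1.le
        rw [h] at this
        linarith
    have h3 := h2 ⟨le_rfl, zero_le_one⟩ ⟨hy0, hy1⟩ hy0
    simp only [clampedExpPotential_zero] at h3
    nlinarith
  · have hmono : AntitoneOn clampedExpPotential (Iic 0) := by
      refine antitoneOn_of_hasDerivWithinAt_nonpos (convex_Iic 0) hc.continuousOn
        (fun x _ => (hasDerivAt_clampedExpPotential x).hasDerivWithinAt) fun x hx => ?_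
      have hx : x < (0 : ℝ) := by simpa using hx
      have := clampedExpSubOne_le_half_unitClamp hx.le
      have h : unitClamp x ≤ 0 := by unfold unitClamp; grind
      linarith
    have hy0 : unitClamp x ≤ 0 := by unfold unitClamp; grind
    have hy1 := (unitClamp_mem x).1
    have hyx : x ≤ unitClamp x := by unfold unitClamp; grind
    have h1 := hmono hx hy0 hyx
    have h2 : AntitoneOn (fun t => clampedExpPotential t - t ^ 2 / 4) (Icc (-1) 0) := by
      refine antitoneOn_of_hasDerivWithinAt_nonpos (f' := fun t => clampedExpSubOne t - t / 2)
        (convex_Icc (-1) 0) (by fun_prop) (fun t _ => HasDerivAt.hasDerivWithinAt ?_) fun t ht => ?_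
      · have := (hasDerivAt_clampedExpPotential t).sub ((hasDerivAt_pow 2 t).div_const 4)
        convert! this using 1
        simp; ring
      · have ht : t ∈ Ioo (-1 : ℝ) 0 := by simpa using ht
        have h : unitClamp t = t := by unfold unitClamp; grind
        have := clampedExpSubOne_le_half_unitClamp ht.2.le
        rw [h] at this
        linarith
    have h3 := h2 ⟨hy1, hy0⟩ ⟨by norm_num, le_rfl⟩ hy0
    simp only [clampedExpPotential_zero] at h3
    nlinarith

theorem clampedExpPotential_nonneg (x : ℝ) : 0 ≤ clampedExpPotential x := by
  nlinarith [unitClamp_sq_le x, sq_nonneg (unitClamp x)]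

theorem abs_clampedExpSubOne_le_sqrt (x : ℝ) :
    |clampedExpSubOne x| ≤ 6 * √(clampedExpPotential x) := by
  have h1 := abs_clampedExpSubOne_le x
  have h2 : |unitClamp x| ≤ 3 * √(clampedExpPotential x) := by
    refine abs_le_of_sq_le_sq ?_ (by positivity)
    rw [mul_pow, Real.sq_sqrt (clampedExpPotential_nonneg x)]
    linarith [unitClamp_sq_le x, clampedExpPotential_nonneg x]
  linarith

/-- A nonnegative quantity `e` with `e' ≥ -(M / s ^ 2) √e` that vanishes at the right end of an
interval is `O(s⁻²)`, with a constant that does not depend on the interval. -/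
theorem le_sq_of_neg_sqrt_le_deriv {e e' : ℝ → ℝ} {a b M : ℝ} (ha : 0 < a)
    (hM : 0 ≤ M) (he : ∀ s, 0 ≤ e s) (heb : e b = 0) (hc : ContinuousOn e (Icc a b))
    (hd : ∀ s ∈ Ioo a b, HasDerivAt e (e' s) s)
    (hle : ∀ s ∈ Ioo a b, -(M / s ^ 2 * √(e s)) ≤ e' s) {s : ℝ} (hs : s ∈ Icc a b) :
    e s ≤ ((1 + M) / s) ^ 2 := by
  have hs0 : 0 < s := ha.trans_le hs.1
  have hb0 : 0 < b := hs0.trans_le hs.2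
  -- The shift by `δ` keeps the square root differentiable.
  set δ : ℝ := (1 / b) ^ 2 with hδ
  have hδ0 : 0 < δ := by positivity
  have hmono : MonotoneOn (fun t => √(e t + δ) - M / t) (Icc a b) := by
    refine monotoneOn_of_hasDerivWithinAt_nonneg
      (f' := fun t => e' t / (2 * √(e t + δ)) - -M / t ^ 2) (convex_Icc a b) ?_ ?_ ?_
    · refine ContinuousOn.sub ((hc.add continuousOn_const).sqrt) ?_
      exact continuousOn_const.div continuousOn_id fun t ht => (ha.trans_le ht.1).ne'
    · intro t ht
      rw [interior_Icc] at ht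
      have ht0 : t ≠ 0 := (ha.trans ht.1).ne'
      have h1 := ((hd t ht).add_const δ).sqrt (by have := he t; positivity)
      have h2 := ((hasDerivAt_inv ht0).const_mul M)
      refine ((h1.sub h2).congr_deriv ?_).hasDerivWithinAt
      ring
    · intro t ht
      rw [interior_Icc] at ht
      have ht0 : 0 < t := ha.trans ht.1
      have h1 := hle t ht
      have hp : 0 < √(e t + δ) := Real.sqrt_pos.2 (by have := he t; positivity)
      have h2 : √(e t) ≤ √(e t + δ) := Real.sqrt_le_sqrt (by linarith)
      have h3 : M / t ^ 2 * √(e t) ≤ M / t ^ 2 * √(e t + δ) := by gcongr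
      have h4 : 0 ≤ M / t ^ 2 := by positivity
      have h5 : -(M / t ^ 2) ≤ e' t / (2 * √(e t + δ)) := by
        rw [le_div_iff₀ (by positivity)]
        nlinarith [mul_nonneg h4 hp.le]
      have : -M / t ^ 2 = -(M / t ^ 2) := by ring
      linarith
  have h := hmono hs ⟨hs.1.trans hs.2, le_rfl⟩ hs.2
  simp only [heb, zero_add] at h
  rw [hδ, Real.sqrt_sq (by positivity)] at h
  have h1 : 1 / b ≤ 1 / s := one_div_le_one_div_of_le hs0 hs.2
  have h2 : 0 ≤ M / b := by positivity
  have h3 : √(e s + (1 / b) ^ 2) ≤ (1 + M) / s := by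
    rw [add_div]; linarith
  have h4 := (Real.sqrt_le_left (by positivity)).1 h3
  have : 0 ≤ (1 / b) ^ 2 := by positivity
  linarith

/-- The perturbed Hamiltonian system
`Z' = -c (exp N - 1)`, `N' = b (1 - exp (-Z)) + 2 c (exp N - 1) + m` with a forcing term
`m = O(s⁻²)` has a solution with `Z, N = O(1/s)`. The energy
`(exp N - 1 - N) + k (exp (-Z) - 1 + Z)` with `k = b / c` nondecreasing controls the solutions that
vanish at a late time, and these converge along a subsequence. -/
theorem exists_decaying_solution {b c k k' m : ℝ → ℝ} {s₁ M : ℝ} (hs₁ : 0 < s₁) (hM : 0 ≤ M)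
    (hb : ContinuousOn b (Ici s₁)) (hc : ContinuousOn c (Ici s₁)) (hm : ContinuousOn m (Ici s₁))
    (hc0 : ∀ s ∈ Ici s₁, 0 < c s) (hkbc : ∀ s ∈ Ici s₁, k s * c s = b s)
    (hk : ∀ s ∈ Ici s₁, HasDerivAt k (k' s) s) (hk' : ∀ s ∈ Ici s₁, 0 ≤ k' s)
    (hk1 : ∀ s ∈ Ici s₁, 1 ≤ k s) (hmM : ∀ s ∈ Ici s₁, |m s| ≤ M / s ^ 2) :
    ∃ s₂ ≥ s₁, ∃ D : ℝ, ∃ Z N : ℝ → ℝ, ∀ s > s₂,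
      HasDerivAt Z (-(c s * (Real.exp (N s) - 1))) s ∧
      HasDerivAt N (b s * (1 - Real.exp (-Z s)) + 2 * c s * (Real.exp (N s) - 1) + m s) s ∧
      |Z s| ≤ D / s ∧ |N s| ≤ D / s := by
  -- The truncated vector field, which is bounded and Lipschitz.
  set v : ℝ → ℝ × ℝ → ℝ × ℝ := fun s y => (-(c s * clampedExpSubOne y.2),
    -(b s * clampedExpSubOne (-y.1)) + 2 * c s * clampedExpSubOne y.2 + m s) with hv
  set D : ℝ := 3 * (1 + 6 * M) with hD
  have hD0 : 0 < D := by positivity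
  set a : ℝ := max s₁ (D + 1) with ha
  have has₁ : s₁ ≤ a := le_max_left _ _
  have ha0 : 0 < a := hs₁.trans_le has₁
  have hIci : Ici a ⊆ Ici s₁ := Ici_subset_Ici.2 has₁
  have hbd : ∀ u : ℝ → ℝ, ContinuousOn u (Ici s₁) → ∀ t : ℝ, ∃ C : ℝ, 0 ≤ C ∧ ∀ s ∈ Icc a t,
      |u s| ≤ C := by
    intro u hu t
    obtain ⟨C, hC⟩ := (isCompact_Icc (a := a) (b := t)).exists_bound_of_continuousOn
      (hu.mono fun s hs => hIci hs.1)
    exact ⟨max C 0, le_max_right _ _, fun s hs => (hC s hs).trans (le_max_left _ _)⟩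
  have hLip : ∀ t, ∃ K : NNReal, ∀ s ∈ Icc a t, LipschitzWith K (v s) := by
    intro t
    obtain ⟨Cb, hCb0, hCb⟩ := hbd b hb t
    obtain ⟨Cc, hCc0, hCc⟩ := hbd c hc t
    refine ⟨⟨3 * Cb + 6 * Cc, by positivity⟩, fun s hs =>
      LipschitzWith.of_dist_le_mul fun y z => ?_⟩
    have hα : ∀ p q : ℝ, |clampedExpSubOne p - clampedExpSubOne q| ≤ 3 * |p - q| := fun p q => by
      simpa [Real.dist_eq] using lipschitzWith_clampedExpSubOne.dist_le_mul p q
    have h1 : |y.1 - z.1| ≤ dist y z := le_max_left _ _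
    have h2 : |y.2 - z.2| ≤ dist y z := le_max_right _ _
    have h3 := hα y.2 z.2
    have h4 := hα (-y.1) (-z.1)
    have h5 : |-y.1 - -z.1| = |y.1 - z.1| := by rw [← abs_neg]; ring_nf
    rw [h5] at h4
    have h6 := hCb s hs
    have h7 := hCc s hs
    have h8 : |c s * (clampedExpSubOne y.2 - clampedExpSubOne z.2)| ≤ Cc * (3 * dist y z) := by
      rw [abs_mul]
      exact mul_le_mul h7 (h3.trans (by linarith)) (abs_nonneg _) hCc0
    have h9 : |b s * (clampedExpSubOne (-y.1) - clampedExpSubOne (-z.1))| ≤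
        Cb * (3 * dist y z) := by
      rw [abs_mul]
      exact mul_le_mul h6 (h4.trans (by linarith)) (abs_nonneg _) hCb0
    have hd0 : 0 ≤ dist y z := dist_nonneg
    have hCbd : 0 ≤ Cb * dist y z := by positivity
    have hCcd : 0 ≤ Cc * dist y z := by positivity
    rw [abs_le] at h8 h9
    rw [Prod.dist_eq]
    change max |_ - _| |_ - _| ≤ (3 * Cb + 6 * Cc) * dist y z
    simp only [hv]
    refine max_le (abs_le.2 ⟨?_, ?_⟩) (abs_le.2 ⟨?_, ?_⟩) <;> linarith
  have hbound : ∀ t, ∃ C : ℝ, ∀ s ∈ Icc a t, ∀ y, ‖v s y‖ ≤ C := by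
    intro t
    obtain ⟨Cb, hCb0, hCb⟩ := hbd b hb t
    obtain ⟨Cc, hCc0, hCc⟩ := hbd c hc t
    obtain ⟨Cm, hCm0, hCm⟩ := hbd m hm t
    refine ⟨2 * Cb + 4 * Cc + Cm, fun s hs y => ?_⟩
    have h8 : |c s * clampedExpSubOne y.2| ≤ Cc * 2 := by
      rw [abs_mul]
      exact mul_le_mul (hCc s hs) (abs_clampedExpSubOne_le_two _) (abs_nonneg _) hCc0
    have h9 : |b s * clampedExpSubOne (-y.1)| ≤ Cb * 2 := by
      rw [abs_mul]
      exact mul_le_mul (hCb s hs) (abs_clampedExpSubOne_le_two _) (abs_nonneg _) hCb0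
    have h10 := hCm s hs
    rw [abs_le] at h8 h9 h10
    rw [Prod.norm_def]
    change max |_| |_| ≤ _
    simp only [hv]
    refine max_le (abs_le.2 ⟨?_, ?_⟩) (abs_le.2 ⟨?_, ?_⟩) <;> linarith
  have hcont : ∀ y, ContinuousOn (fun t => v t y) (Ici a) := by
    intro y
    have := hb.mono hIci
    have := hc.mono hIci
    have := hm.mono hIci
    simp only [hv]
    fun_prop
  have hsmall : ∀ s ∈ Ici a, D / s < 1 := by
    intro s hs
    have : D + 1 ≤ s := (le_max_right _ _).trans hs
    rw [div_lt_one (by linarith)]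
    linarith
  have happrox : ∀ n : ℕ, ∃ y : ℝ → ℝ × ℝ, IsIntegralCurveOn y v (Icc a (a + n)) ∧
      ∀ t ∈ Icc a (a + n), ‖y t‖ ≤ D / t := by
    intro n
    have han : a ≤ a + n := by simp
    obtain ⟨K, hK⟩ := hLip (a + n)
    obtain ⟨C, hC⟩ := hbound (a + n)
    obtain ⟨y, hyn, hy⟩ := exists_isIntegralCurveOn_Icc_of_bounded (v := v)
      (right_mem_Icc.2 han) hK hC (fun y => (hcont y).mono Icc_subset_Ici_self) 0
    refine ⟨y, hy, fun t ht => ?_⟩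
    have hyc := hy.continuousOn
    set e : ℝ → ℝ := fun s => clampedExpPotential (y s).2 + k s * clampedExpPotential (-(y s).1)
      with he
    set e' : ℝ → ℝ := fun s => clampedExpSubOne (y s).2 * (2 * c s * clampedExpSubOne (y s).2 + m s)
      + k' s * clampedExpPotential (-(y s).1) with he'
    have hmem : ∀ s ∈ Icc a (a + n), s ∈ Ici s₁ := fun s hs => hIci hs.1
    have hd : ∀ s ∈ Ioo a (a + n), HasDerivAt e (e' s) s := by
      intro s hs
      have hs' := hmem s (Ioo_subset_Icc_self hs)
      have hys : HasDerivAt y (v s (y s)) s :=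
        (hy s (Ioo_subset_Icc_self hs)).hasDerivAt (Icc_mem_nhds hs.1 hs.2)
      have h1 : HasDerivAt (fun s => (y s).1) (v s (y s)).1 s := hys.fst
      have h2 : HasDerivAt (fun s => (y s).2) (v s (y s)).2 s := hys.snd
      have h3 := (hasDerivAt_clampedExpPotential (y s).2).comp s h2
      have h4 := (hasDerivAt_clampedExpPotential (-(y s).1)).comp s (h1.fun_neg)
      refine (h3.add ((hk s hs').mul h4)).congr_deriv ?_
      simp only [hv, he', Function.comp, ← hkbc s hs']
      ring
    have hkc : ContinuousOn k (Icc a (a + n)) := fun s hs =>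
      (hk s (hmem s hs)).continuousAt.continuousWithinAt
    have hpc : Continuous clampedExpPotential :=
      continuous_iff_continuousAt.2 fun x => (hasDerivAt_clampedExpPotential x).continuousAt
    have hec : ContinuousOn e (Icc a (a + n)) := by
      have h1 : ContinuousOn (fun s => (y s).1) (Icc a (a + n)) := hyc.fst
      have h2 : ContinuousOn (fun s => (y s).2) (Icc a (a + n)) := hyc.snd
      exact (hpc.comp_continuousOn h2).add (hkc.mul (hpc.comp_continuousOn h1.neg))
    have hen : e (a + n) = 0 := by
      simp [he, hyn, clampedExpPotential_zero]
    have hle : ∀ s ∈ Ioo a (a + n), -(6 * M / s ^ 2 * √(max (e s) 0)) ≤ e' s := by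
      intro s hs
      have hs' := hmem s (Ioo_subset_Icc_self hs)
      have hs0 : 0 < s := ha0.trans hs.1
      have h1 := clampedExpPotential_nonneg (-(y s).1)
      have h2 := hk1 s hs'
      have h3 : 0 ≤ k s * clampedExpPotential (-(y s).1) := by positivity
      have h4 : √(clampedExpPotential (y s).2) ≤ √(max (e s) 0) :=
        Real.sqrt_le_sqrt (le_max_of_le_left (by simp only [he]; linarith))
      have h5 := (abs_clampedExpSubOne_le_sqrt (y s).2).trans
        (mul_le_mul_of_nonneg_left h4 (by norm_num))
      have h6 : |clampedExpSubOne (y s).2 * m s| ≤ 6 * √(max (e s) 0) * (M / s ^ 2) := by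
        rw [abs_mul]
        exact mul_le_mul h5 (hmM s hs') (abs_nonneg _) (by positivity)
      have h7 := (abs_le.1 h6).1
      have h8 : 0 ≤ k' s * clampedExpPotential (-(y s).1) := mul_nonneg (hk' s hs') h1
      have h9 : 0 ≤ 2 * c s * clampedExpSubOne (y s).2 ^ 2 := by
        have := hc0 s hs'
        positivity
      have h10 : 6 * M / s ^ 2 * √(max (e s) 0) = 6 * √(max (e s) 0) * (M / s ^ 2) := by ring
      simp only [he']
      rw [h10]
      nlinarith
    have henn : ∀ s ∈ Icc a (a + n), 0 ≤ e s := by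
      intro s hs
      have h1 := clampedExpPotential_nonneg (-(y s).1)
      have h2 := hk1 s (hmem s hs)
      have h3 := clampedExpPotential_nonneg (y s).2
      have : 0 ≤ k s := by linarith
      simp only [he]
      positivity
    -- The energy is nonnegative on the half line where `k` is controlled, hence equals its maximum
    -- with `0` there.
    have hE := le_sq_of_neg_sqrt_le_deriv (e := fun s => max (e s) 0) (e' := e') ha0
      (by positivity : 0 ≤ 6 * M) (fun s => le_max_right _ _) (by simp [hen])
      (hec.sup continuousOn_const)
      (fun s hs => (hd s hs).congr_of_eventuallyEq (by
        filter_upwards [Icc_mem_nhds hs.1 hs.2] with r hr using max_eq_left (henn r hr)))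
      hle ht
    have ht0 : 0 < t := ha0.trans_le ht.1
    have hE' : e t ≤ ((1 + 6 * M) / t) ^ 2 := (le_max_left _ _).trans hE
    have hk1t := hk1 t (hmem t ht)
    have h1 := clampedExpPotential_nonneg (-(y t).1)
    have h2 := clampedExpPotential_nonneg (y t).2
    have h3 : clampedExpPotential (-(y t).1) ≤ k t * clampedExpPotential (-(y t).1) :=
      le_mul_of_one_le_left h1 hk1t
    have hDt : (D / t) ^ 2 = 9 * ((1 + 6 * M) / t) ^ 2 := by rw [hD]; ring
    have hDt0 : 0 ≤ D / t := by positivity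
    have hlt := hsmall t ht.1
    simp only [he] at hE'
    have hsq : 0 ≤ ((1 + 6 * M) / t) ^ 2 := by positivity
    have hZ : |unitClamp (y t).1| ≤ D / t := by
      rw [← abs_neg, ← unitClamp_neg]
      refine abs_le_of_sq_le_sq ?_ hDt0
      rw [hDt]
      linarith [unitClamp_sq_le (-(y t).1)]
    have hN : |unitClamp (y t).2| ≤ D / t := by
      refine abs_le_of_sq_le_sq ?_ hDt0
      rw [hDt]
      linarith [unitClamp_sq_le (y t).2]
    rw [unitClamp_eq_self_of_abs_lt (hZ.trans_lt hlt)] at hZ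
    rw [unitClamp_eq_self_of_abs_lt (hN.trans_lt hlt)] at hN
    exact max_le hZ hN
  obtain ⟨y, hy, hyB⟩ := exists_isIntegralCurveOn_Ici_of_bound hLip hbound hcont happrox
  refine ⟨a, has₁, D, fun s => (y s).1, fun s => (y s).2, fun s hs => ?_⟩
  have hys : HasDerivAt y (v s (y s)) s := (hy s (le_of_lt hs)).hasDerivAt (Ici_mem_nhds hs)
  have hn := hyB s (le_of_lt hs)
  have hZ : |(y s).1| ≤ D / s := (norm_fst_le (y s)).trans hn
  have hN : |(y s).2| ≤ D / s := (norm_snd_le (y s)).trans hn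
  have hlt := hsmall s (le_of_lt hs)
  have hid : ∀ x : ℝ, |x| < 1 → clampedExpSubOne x = Real.exp x - 1 := by
    intro x hx
    have := abs_lt.1 hx
    have h : unitClamp x = x := by unfold unitClamp; grind
    simp [clampedExpSubOne, h]
  refine ⟨?_, ?_, hZ, hN⟩
  · have h : HasDerivAt (fun s => (y s).1) (v s (y s)).1 s := hys.fst
    refine h.congr_deriv ?_
    simp only [hv]
    rw [hid _ (hN.trans_lt hlt)]
  · have h : HasDerivAt (fun s => (y s).2) (v s (y s)).2 s := hys.snd
    refine h.congr_deriv ?_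
    simp only [hv]
    rw [hid _ (hN.trans_lt hlt), hid _ (by rw [abs_neg]; exact hZ.trans_lt hlt)]
    ring

/-! ### The inverse of `g` and logarithmic derivatives of `H` -/

/-- The inverse function theorem for an increasing function on a half line. -/
theorem exists_inverse_of_hasDerivAt_pos {φ φ' : ℝ → ℝ} {a : ℝ}
    (hd : ∀ x ≥ a, HasDerivAt φ (φ' x) x) (hpos : ∀ x ≥ a, 0 < φ' x)
    (htop : Tendsto φ atTop atTop) :
    ∃ ψ : ℝ → ℝ, (∀ y > φ a, a < ψ y ∧ φ (ψ y) = y ∧ HasDerivAt ψ (φ' (ψ y))⁻¹ y) ∧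
      (∀ x > a, ψ (φ x) = x) ∧ Tendsto ψ atTop atTop := by
  have hcont : ContinuousOn φ (Ici a) := fun x hx => (hd x hx).continuousAt.continuousWithinAt
  have hmono : StrictMonoOn φ (Ici a) := by
    refine strictMonoOn_of_hasDerivWithinAt_pos (convex_Ici a) hcont
      (fun x hx => (hd x (interior_subset hx)).hasDerivWithinAt)
      fun x hx => hpos x (interior_subset hx)
  have hsurj : ∀ y > φ a, ∃ x ∈ Ioi a, φ x = y := by
    intro y hy
    obtain ⟨b, hb, hab⟩ := ((htop.eventually_gt_atTop y).and (eventually_ge_atTop a)).exists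
    obtain ⟨x, hx, hxy⟩ := intermediate_value_Icc hab (hcont.mono Icc_subset_Ici_self)
      ⟨hy.le, hb.le⟩
    refine ⟨x, lt_of_le_of_ne hx.1 ?_, hxy⟩
    rintro rfl
    exact hy.ne hxy
  set ψ := Function.invFunOn φ (Ioi a) with hψ
  have h1 : ∀ y > φ a, a < ψ y := fun y hy => Function.invFunOn_mem (hsurj y hy)
  have h2 : ∀ y > φ a, φ (ψ y) = y := fun y hy => Function.invFunOn_eq (hsurj y hy)
  have h3 : ∀ x > a, ψ (φ x) = x := by
    intro x hx
    have hy : φ x > φ a := hmono self_mem_Ici (le_of_lt hx) hx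
    exact hmono.injOn (le_of_lt (h1 _ hy)) (le_of_lt hx) (h2 _ hy)
  have h4 : StrictMonoOn ψ (Ioi (φ a)) := by
    intro y hy z hz hyz
    rwa [← hmono.lt_iff_lt (le_of_lt (h1 y hy)) (le_of_lt (h1 z hz)), h2 y hy, h2 z hz]
  have h5 : ∀ y > φ a, ContinuousAt ψ y := by
    intro y hy
    refine h4.continuousAt_of_image_mem_nhds (Ioi_mem_nhds hy) ?_
    refine mem_of_superset (Ioi_mem_nhds (h1 y hy)) fun x hx => ?_
    have hx' : a < x := hx
    exact ⟨φ x, hmono self_mem_Ici hx'.le hx', h3 x hx⟩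
  refine ⟨ψ, fun y hy => ⟨h1 y hy, h2 y hy, ?_⟩, h3, ?_⟩
  · refine HasDerivAt.of_local_left_inverse (h5 y hy) (hd _ (h1 y hy).le)
      (hpos _ (h1 y hy).le).ne' ?_
    filter_upwards [Ioi_mem_nhds hy] with z hz using h2 z hz
  · refine tendsto_atTop.2 fun b => ?_
    have hc : φ a < φ (max b (a + 1)) := by
      have h6 : a < max b (a + 1) := lt_max_of_lt_right (by linarith)
      exact hmono self_mem_Ici h6.le h6
    filter_upwards [eventually_gt_atTop (φ (max b (a + 1)))] with y hy
    have h6 := h4 hc (hc.trans hy) hy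
    rw [h3 _ (lt_max_of_lt_right (by linarith))] at h6
    exact (le_max_left _ _).trans h6.le

/-- A Landau-type interpolation in the logarithmic variable: if `h` converges, and its second
logarithmic derivative is bounded, then its first logarithmic derivative tends to `0`. -/
theorem tendsto_zero_of_log_deriv {h h₁ h₂ : ℝ → ℝ} {w₀ C l : ℝ} (hw₀ : 0 < w₀)
    (hh : ∀ w > w₀, HasDerivAt h (h₁ w / w) w) (hh₁ : ∀ w > w₀, HasDerivAt h₁ (h₂ w / w) w)
    (hC : ∀ w > w₀, |h₂ w| ≤ C) (hl : Tendsto h atTop (𝓝 l)) : Tendsto h₁ atTop (𝓝 0) := by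
  have hC0 : 0 ≤ C := (abs_nonneg _).trans (hC (w₀ + 1) (by linarith))
  rw [Metric.tendsto_nhds]
  intro ε hε
  set δ : ℝ := ε / (2 * (C + 1)) with hδ
  have hδ0 : 0 < δ := by positivity
  have hCδ : C * δ < ε / 2 := by
    rw [hδ, mul_div_assoc', div_lt_div_iff₀ (by positivity) (by positivity)]
    nlinarith
  have hlim : Tendsto (fun w => |h ((1 + δ) * w) - h w| * ((1 + δ) / δ)) atTop (𝓝 0) := by
    have h1 : Tendsto (fun w => h ((1 + δ) * w)) atTop (𝓝 l) :=
      hl.comp (tendsto_id.const_mul_atTop (by positivity))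
    simpa using ((h1.sub hl).abs).mul_const ((1 + δ) / δ)
  filter_upwards [hlim.eventually_lt_const (half_pos hε), eventually_gt_atTop w₀] with w hw hww
  have hw0 : 0 < w := hw₀.trans hww
  have hlt : w < (1 + δ) * w := by nlinarith
  obtain ⟨ξ, hξ, hξe⟩ := exists_hasDerivAt_eq_slope h (fun w => h₁ w / w) hlt
    (fun x hx => (hh x (hww.trans_le hx.1)).continuousAt.continuousWithinAt)
    (fun x hx => hh x (hww.trans hx.1))
  have hξ0 : 0 < ξ := hw0.trans hξ.1
  have hb : |h₁ ξ| ≤ |h ((1 + δ) * w) - h w| * ((1 + δ) / δ) := by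
    have e1 : h₁ ξ = (h ((1 + δ) * w) - h w) * (ξ / (δ * w)) := by
      have : (1 + δ) * w - w = δ * w := by ring
      rw [this] at hξe
      field_simp at hξe ⊢
      linarith
    rw [e1, abs_mul]
    gcongr
    rw [abs_of_pos (by positivity), div_le_div_iff₀ (by positivity) (by positivity)]
    have := hξ.2
    nlinarith
  have hd : |h₁ ξ - h₁ w| ≤ C * δ := by
    have h1 := (convex_Icc w ξ).norm_image_sub_le_of_norm_hasDerivWithin_le (f := h₁)
      (f' := fun w => h₂ w / w) (C := C / w)
      (fun x hx => (hh₁ x (hww.trans_le hx.1)).hasDerivWithinAt) (fun x hx => by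
        rw [Real.norm_eq_abs, abs_div, abs_of_pos (hw0.trans_le hx.1)]
        exact div_le_div₀ hC0 (hC x (hww.trans_le hx.1)) hw0 hx.1)
      (left_mem_Icc.2 hξ.1.le) (right_mem_Icc.2 hξ.1.le)
    rw [Real.norm_eq_abs, Real.norm_eq_abs, abs_of_pos (sub_pos.2 hξ.1)] at h1
    refine h1.trans ?_
    rw [div_mul_eq_mul_div, div_le_iff₀ hw0]
    have := hξ.2
    nlinarith
  rw [Real.dist_eq, sub_zero]
  have := abs_sub_abs_le_abs_sub (h₁ w) (h₁ ξ)
  rw [abs_sub_comm] at this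
  linarith

section Profile

variable {g : ℝ → ℝ} {q : ℝ}

theorem ContDiffOn.iteratedDeriv_Ioi {F : ℝ → ℝ} {a : ℝ} {n k : ℕ}
    (hF : ContDiffOn ℝ n F (Ioi a)) (hk : k ≤ n) :
    ContDiffOn ℝ (n - k : ℕ) (iteratedDeriv k F) (Ioi a) := by
  induction k with
  | zero => simpa using hF
  | succ k ih =>
    rw [iteratedDeriv_succ]
    refine (ih (by omega)).deriv_of_isOpen isOpen_Ioi ?_
    norm_cast
    omega

theorem ContDiffOn.hasDerivAt_iteratedDeriv {F : ℝ → ℝ} {a s : ℝ} {n k : ℕ}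
    (hF : ContDiffOn ℝ n F (Ioi a)) (hk : k < n) (hs : a < s) :
    HasDerivAt (iteratedDeriv k F) (iteratedDeriv (k + 1) F s) s := by
  have h2 := (hF.iteratedDeriv_Ioi hk.le).contDiffAt (Ioi_mem_nhds hs)
  rw [iteratedDeriv_succ]
  exact (h2.differentiableAt (by norm_cast; omega)).hasDerivAt

/-- Under (G1) and (G2) the exponent `q` is positive: for `q < 0` the function `g` would be concave
near infinity, and `1 / g` not integrable. -/
theorem CondG1.q_pos (hq : q ≠ 0) (hG1 : CondG1 g q) (hG2 : CondG2 g) : 0 < q := by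
  by_contra hneg
  have hq0 : q < 0 := lt_of_le_of_ne (not_lt.1 hneg) hq
  obtain ⟨hpos, hint, hlim⟩ := hG1
  obtain ⟨C, hC, s₀, hs₀, hdiff, -⟩ := hG2
  have hHneg : ∀ᶠ s in atTop, HQuot g s < 0 :=
    hlim.eventually_lt_const (one_div_neg.2 hq0)
  obtain ⟨a, ha⟩ := eventually_atTop.1
    (hpos.and (hint.and (hHneg.and (eventually_gt_atTop s₀))))
  have hd1 : ∀ s ≥ a, HasDerivAt g (deriv g s) s := fun s hs => by
    simpa [iteratedDeriv_one] using hdiff.hasDerivAt_iteratedDeriv (n := 5) (k := 0) (by norm_num)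
      (ha s hs).2.2.2
  have hd2 : ∀ s ≥ a, HasDerivAt (deriv g) (iteratedDeriv 2 g s) s := fun s hs => by
    simpa [iteratedDeriv_one] using hdiff.hasDerivAt_iteratedDeriv (n := 5) (k := 1) (by norm_num)
      (ha s hs).2.2.2
  have hg2 : ∀ s ≥ a, iteratedDeriv 2 g s ≤ 0 := by
    intro s hs
    by_contra h
    have h1 := (ha s hs).2.2.1
    have h2 : 0 ≤ HQuot g s := by
      unfold HQuot
      have := (ha s hs).1
      have := not_le.1 h
      positivity
    linarith
  have hanti : AntitoneOn (deriv g) (Ici a) :=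
    antitoneOn_of_hasDerivWithinAt_nonpos (convex_Ici a)
      (fun s hs => (hd2 s hs).continuousAt.continuousWithinAt)
      (fun s hs => (hd2 s (interior_subset hs)).hasDerivWithinAt)
      (fun s hs => hg2 s (interior_subset hs))
  set d : ℝ := max (deriv g a) 1 with hd
  have hlin : ∀ s ≥ a, g s ≤ g a + d * (s - a) := by
    intro s hs
    have h1 := (convex_Icc a s).image_sub_le_mul_sub_of_deriv_le (f := g) (C := d)
      (fun t ht => (hd1 t ht.1).continuousAt.continuousWithinAt)
      (fun t ht => (hd1 t (interior_subset ht).1).differentiableAt.differentiableWithinAt)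
      (fun t ht => (hanti self_mem_Ici (interior_subset ht).1 (interior_subset ht).1).trans
        (le_max_left _ _)) a (left_mem_Icc.2 hs) s (right_mem_Icc.2 hs) hs
    linarith
  have hd0 : 0 < d := lt_max_of_lt_right one_pos
  have hga : 0 < g a := (ha a le_rfl).1
  set p : ℝ := g a / d with hp
  have hp0 : 0 < p := by positivity
  -- `1 / g` dominates a multiple of `1 / (s - a + p)`.
  have hint' : IntegrableOn (fun s => (s - (a - p))⁻¹) (Ioi a) := by
    have h1 := (ha a le_rfl).2.1.const_mul d
    refine h1.mono' (by fun_prop) ?_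
    refine (ae_restrict_mem measurableSet_Ioi).mono fun s hs => ?_
    have hs : a < s := hs
    have h2 := hlin s hs.le
    have h3 := (ha s hs.le).1
    have h4 : d * (s - (a - p)) = g a + d * (s - a) := by
      rw [hp]; field_simp; ring
    have h5 : 0 < s - (a - p) := by linarith
    rw [Real.norm_eq_abs, abs_of_pos (by positivity), ← one_div, mul_one_div,
      div_le_div_iff₀ h5 h3]
    linarith
  have hcomp : IntegrableOn (fun s : ℝ => s⁻¹) (Ioi p) := by
    have h1 : IntegrableOn ((fun s : ℝ => s⁻¹) ∘ fun s => s - (a - p))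
        ((fun s => s - (a - p)) ⁻¹' Ioi p) := by
      convert! hint' using 1
      ext s
      simp
    exact ((measurePreserving_sub_right volume (a - p)).integrableOn_comp_preimage
      (MeasurableEquiv.subRight (a - p)).measurableEmbedding).1 h1
  exact not_integrableOn_Ioi_inv hcomp

/-- The inverse `G` of `g` near infinity, and `HQuot g ∘ G` together with its logarithmic
derivatives `h₁`, `h₂`, `h₃` up to third order. By (G2) these are bounded. -/
structure LogProfile (g : ℝ → ℝ) (q : ℝ) where
  (w₀ C : ℝ)
  (G h₁ h₂ h₃ : ℝ → ℝ)
  w₀_pos : 0 < w₀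
  q_pos : 0 < q
  tendsto_G : Tendsto G atTop atTop
  tendsto_h : Tendsto (fun w => HQuot g (G w)) atTop (𝓝 (1 / q))
  G_pos : ∀ w > w₀, 0 < G w
  g_G : ∀ w > w₀, g (G w) = w
  gInv_eq : ∀ w > w₀, gInv g w = G w
  deriv_pos : ∀ w > w₀, 0 < deriv g (G w)
  h_pos : ∀ w > w₀, 0 < HQuot g (G w)
  hasDerivAt_G : ∀ w > w₀, HasDerivAt G (deriv g (G w))⁻¹ w
  hasDerivAt_deriv : ∀ w > w₀,
    HasDerivAt (fun w => deriv g (G w)) (HQuot g (G w) * deriv g (G w) / w) w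
  hasDerivAt_h : ∀ w > w₀, HasDerivAt (fun w => HQuot g (G w)) (h₁ w / w) w
  hasDerivAt_h₁ : ∀ w > w₀, HasDerivAt h₁ (h₂ w / w) w
  hasDerivAt_h₂ : ∀ w > w₀, HasDerivAt h₂ (h₃ w / w) w
  continuousOn_h₃ : ContinuousOn h₃ (Ioi w₀)
  abs_h₁_le : ∀ w > w₀, |h₁ w| ≤ C
  abs_h₂_le : ∀ w > w₀, |h₂ w| ≤ C
  abs_h₃_le : ∀ w > w₀, |h₃ w| ≤ C

theorem nonempty_logProfile (hgc : ContinuousOn g (Ici 0)) (hq : q ≠ 0) (hG1 : CondG1 g q)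
    (hG2 : CondG2 g) : Nonempty (LogProfile g q) := by
  have hq0 := hG1.q_pos hq hG2
  obtain ⟨hpos, -, hlim⟩ := hG1
  obtain ⟨C, hC, s₀, hs₀, hdiff, hbd⟩ := hG2
  have hH0 : ∀ᶠ s in atTop, 0 < HQuot g s := hlim.eventually_const_lt (one_div_pos.2 hq0)
  have hH1 : ∀ᶠ s in atTop, HQuot g s < 1 / q + 1 := hlim.eventually_lt_const (by linarith)
  obtain ⟨a, ha⟩ := eventually_atTop.1
    (hpos.and (hH0.and (hH1.and (eventually_gt_atTop s₀))))
  have has₀ : s₀ < a := (ha a le_rfl).2.2.2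
  have ha0 : 0 < a := hs₀.trans has₀
  have hs₀' : ∀ s ≥ a, s₀ < s := fun s hs => has₀.trans_le hs
  have hgpos : ∀ s ≥ a, 0 < g s := fun s hs => (ha s hs).1
  have hd1 : ∀ s > s₀, HasDerivAt g (deriv g s) s := fun s hs => by
    simpa [iteratedDeriv_one] using hdiff.hasDerivAt_iteratedDeriv (n := 5) (k := 0) (by norm_num)
      hs
  have hd2 : ∀ s > s₀, HasDerivAt (deriv g) (iteratedDeriv 2 g s) s := fun s hs => by
    simpa [iteratedDeriv_one] using hdiff.hasDerivAt_iteratedDeriv (n := 5) (k := 1) (by norm_num)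
      hs
  have hratio : ∀ s > s₀, 0 < deriv g s / g s := by
    intro s hs
    have h1 := hbd 1 (by simp) s hs
    rw [pow_one] at h1
    exact pos_of_mul_pos_right ((abs_nonneg _).trans_lt h1) hC.le
  have hg' : ∀ s ≥ a, 0 < deriv g s := by
    intro s hs
    have := mul_pos (hratio s (hs₀' s hs)) (hgpos s hs)
    rwa [div_mul_cancel₀ _ (hgpos s hs).ne'] at this
  have hne : ∀ s > s₀, deriv g s ≠ 0 := by
    intro s hs h
    simpa [h] using hratio s hs
  have hHdiff : ContDiffOn ℝ 3 (HQuot g) (Ioi s₀) := by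
    have e1 : ContDiffOn ℝ 4 (deriv g) (Ioi s₀) :=
      hdiff.deriv_of_isOpen isOpen_Ioi (by norm_num)
    have e2 : ContDiffOn ℝ 3 (iteratedDeriv 2 g) (Ioi s₀) := by
      have : iteratedDeriv 2 g = deriv (deriv g) := by
        rw [iteratedDeriv_succ, iteratedDeriv_one]
      rw [this]
      exact e1.deriv_of_isOpen isOpen_Ioi (by norm_num)
    have e3 : ContDiffOn ℝ 3 g (Ioi s₀) := hdiff.of_le (by norm_num)
    have e4 : ContDiffOn ℝ 3 (deriv g) (Ioi s₀) := e1.of_le (by norm_num)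
    exact (e3.mul e2).div (e4.pow 2) fun s hs => pow_ne_zero 2 (hne s hs)
  have hH' : ∀ k < 3, ∀ s ≥ a,
      HasDerivAt (iteratedDeriv k (HQuot g)) (iteratedDeriv (k + 1) (HQuot g) s) s :=
    fun k hk s hs => hHdiff.hasDerivAt_iteratedDeriv (n := 3) hk (hs₀' s hs)
  -- `g'` increases, so `g` tends to infinity.
  have hmono' : MonotoneOn (deriv g) (Ici a) := by
    refine monotoneOn_of_hasDerivWithinAt_nonneg (convex_Ici a)
      (fun s hs => (hd2 s (hs₀' s hs)).continuousAt.continuousWithinAt)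
      (fun s hs => (hd2 s (hs₀' s (interior_subset hs))).hasDerivWithinAt) fun s hs => ?_
    have hs' : a ≤ s := interior_subset hs
    by_contra h
    have h1 := (ha s hs').2.1
    have h2 : HQuot g s ≤ 0 := by
      unfold HQuot
      exact div_nonpos_of_nonpos_of_nonneg
        (mul_nonpos_of_nonneg_of_nonpos (hgpos s hs').le (not_le.1 h).le) (sq_nonneg _)
    linarith
  have htop : Tendsto g atTop atTop := by
    have hlin : ∀ s ≥ a, g a + deriv g a * (s - a) ≤ g s := by
      intro s hs
      have h1 := (convex_Icc a s).mul_sub_le_image_sub_of_le_deriv (f := g) (C := deriv g a)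
        (fun t ht => (hd1 t (hs₀' t ht.1)).continuousAt.continuousWithinAt)
        (fun t ht =>
          (hd1 t (hs₀' t (interior_subset ht).1)).differentiableAt.differentiableWithinAt)
        (fun t ht => hmono' self_mem_Ici (interior_subset ht).1 (interior_subset ht).1)
        a (left_mem_Icc.2 hs) s (right_mem_Icc.2 hs) hs
      linarith
    refine tendsto_atTop_mono' atTop ((eventually_ge_atTop a).mono hlin) ?_
    refine tendsto_atTop_add_const_left _ _ (Tendsto.const_mul_atTop (hg' a le_rfl) ?_)
    exact tendsto_atTop_add_const_right _ _ tendsto_id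
  obtain ⟨G, hG, hGg, hGtop⟩ := exists_inverse_of_hasDerivAt_pos (a := a)
    (fun s hs => hd1 s (hs₀' s hs)) hg' htop
  obtain ⟨B, hB⟩ := (isCompact_Icc (a := (0 : ℝ)) (b := a)).exists_bound_of_continuousOn
    (hgc.mono Icc_subset_Ici_self)
  have hBg : ∀ s ∈ Icc 0 a, g s ≤ B := fun s hs => (le_abs_self _).trans (hB s hs)
  set w₀ : ℝ := max B (g a) with hw₀
  have hw : ∀ w > w₀, w > g a := fun w h => (le_max_right _ _).trans_lt h
  have hw₀pos : 0 < w₀ := (hgpos a le_rfl).trans_le (le_max_right _ _)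
  -- The logarithmic derivatives of `H`, as functions of the original variable.
  set L : ℝ → ℝ := fun s => g s / deriv g s with hL
  set H : ℝ → ℝ := HQuot g with hHdef
  set N₁ : ℝ → ℝ := fun s => L s * iteratedDeriv 1 H s with hN₁
  set N₂ : ℝ → ℝ := fun s => L s * ((1 - H s) * iteratedDeriv 1 H s + L s * iteratedDeriv 2 H s)
    with hN₂
  set N₃ : ℝ → ℝ := fun s => L s * ((1 - H s) * ((1 - H s) * iteratedDeriv 1 H s
    + L s * iteratedDeriv 2 H s) + L s * (-iteratedDeriv 1 H s * iteratedDeriv 1 H s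
    + (1 - H s) * iteratedDeriv 2 H s + ((1 - H s) * iteratedDeriv 2 H s
    + L s * iteratedDeriv 3 H s))) with hN₃
  have hLd : ∀ s ≥ a, HasDerivAt L (1 - H s) s := by
    intro s hs
    have h1 := (hd1 s (hs₀' s hs)).div (hd2 s (hs₀' s hs)) (hg' s hs).ne'
    refine h1.congr_deriv ?_
    have := (hg' s hs).ne'
    simp only [hHdef, HQuot]
    field_simp
  have hHd : ∀ s ≥ a, HasDerivAt H (iteratedDeriv 1 H s) s := fun s hs => by
    simpa using hH' 0 (by norm_num) s hs
  have hN₁d : ∀ s ≥ a, HasDerivAt N₁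
      ((1 - H s) * iteratedDeriv 1 H s + L s * iteratedDeriv 2 H s) s := fun s hs =>
    (hLd s hs).mul (hH' 1 (by norm_num) s hs)
  have hN₂d : ∀ s ≥ a, HasDerivAt N₂ ((1 - H s) * ((1 - H s) * iteratedDeriv 1 H s
    + L s * iteratedDeriv 2 H s) + L s * (-iteratedDeriv 1 H s * iteratedDeriv 1 H s
    + (1 - H s) * iteratedDeriv 2 H s + ((1 - H s) * iteratedDeriv 2 H s
    + L s * iteratedDeriv 3 H s))) s := fun s hs =>
    (hLd s hs).mul ((((hHd s hs).const_sub 1).mul (hH' 1 (by norm_num) s hs)).add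
      ((hLd s hs).mul (hH' 2 (by norm_num) s hs)))
  have hcomp : ∀ (N N' : ℝ → ℝ), (∀ s ≥ a, HasDerivAt N (N' s) s) → ∀ w > w₀,
      HasDerivAt (fun w => N (G w)) (L (G w) * N' (G w) / w) w := by
    intro N N' hN w hww
    obtain ⟨e1, e2, e3⟩ := hG w (hw w hww)
    have hw0 : w ≠ 0 := (hw₀pos.trans hww).ne'
    refine ((hN _ e1.le).comp w e3).congr_deriv ?_
    simp only [hL, e2]
    field_simp
  have hLk : ∀ k ∈ Finset.Icc 1 3, ∀ s ≥ a, |L s ^ k * iteratedDeriv k H s| ≤ C := by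
    intro k hk s hs
    have h1 := hbd k hk s (hs₀' s hs)
    have h2 : 0 < L s := div_pos (hgpos s hs) (hg' s hs)
    have h3 : (deriv g s / g s) ^ k = (L s ^ k)⁻¹ := by
      rw [← inv_pow, hL, inv_div]
    rw [h3, ← div_eq_mul_inv, lt_div_iff₀ (by positivity)] at h1
    rw [abs_mul, abs_of_pos (by positivity : 0 < L s ^ k), mul_comm]
    exact h1.le
  set K : ℝ := 1 / q + 2 with hK
  have hK0 : 0 < K := by positivity
  have h1H : ∀ s ≥ a, |1 - H s| ≤ K := by
    intro s hs
    have h1 := (ha s hs).2.1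
    have h2 := (ha s hs).2.2.1
    rw [abs_le]
    constructor <;> rw [hK] <;> linarith
  have hL1 : ∀ s ≥ a, |L s * iteratedDeriv 1 H s| ≤ C := fun s hs => by
    simpa using hLk 1 (by simp) s hs
  have hL2 := hLk 2 (by simp)
  have hL3 := hLk 3 (by simp)
  have hM : ∀ {x y X Y : ℝ}, |x| ≤ X → |y| ≤ Y → |x * y| ≤ X * Y := fun {x y X Y} hx hy => by
    rw [abs_mul]
    exact mul_le_mul hx hy (abs_nonneg _) ((abs_nonneg _).trans hx)
  set C' : ℝ := C + (K * C + C) + (K * (K * C) + 3 * (K * C) + C * C + C) with hC'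
  refine ⟨{
    w₀ := w₀
    C := C'
    G := G
    h₁ := fun w => N₁ (G w)
    h₂ := fun w => N₂ (G w)
    h₃ := fun w => N₃ (G w)
    w₀_pos := hw₀pos
    q_pos := hq0
    tendsto_G := hGtop
    tendsto_h := hlim.comp hGtop
    G_pos := fun w hww => ha0.trans (hG w (hw w hww)).1
    g_G := fun w hww => (hG w (hw w hww)).2.1
    gInv_eq := ?_
    deriv_pos := fun w hww => hg' _ (hG w (hw w hww)).1.le
    h_pos := fun w hww => (ha _ (hG w (hw w hww)).1.le).2.1
    hasDerivAt_G := fun w hww => (hG w (hw w hww)).2.2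
    hasDerivAt_deriv := ?_
    hasDerivAt_h := fun w hww => hcomp H _ hHd w hww
    hasDerivAt_h₁ := fun w hww => hcomp N₁ _ hN₁d w hww
    hasDerivAt_h₂ := fun w hww => hcomp N₂ _ hN₂d w hww
    continuousOn_h₃ := ?_
    abs_h₁_le := ?_
    abs_h₂_le := ?_
    abs_h₃_le := ?_ }⟩
  · intro w hww
    have hex : ∃ s ∈ Ici (0 : ℝ), g s = w :=
      ⟨G w, (ha0.trans (hG w (hw w hww)).1).le, (hG w (hw w hww)).2.1⟩
    have h1 : gInv g w ∈ Ici (0 : ℝ) := Function.invFunOn_mem hex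
    have h2 : g (gInv g w) = w := Function.invFunOn_eq hex
    have h3 : a < gInv g w := by
      by_contra h
      have := hBg _ ⟨h1, not_lt.1 h⟩
      rw [h2] at this
      exact absurd (this.trans (le_max_left _ _)) (not_le.2 hww)
    rw [← hGg _ h3, h2]
  · intro w hww
    have h1 := hcomp (deriv g) _ (fun s hs => hd2 s (hs₀' s hs)) w hww
    refine h1.congr_deriv ?_
    have := (hg' _ (hG w (hw w hww)).1.le).ne'
    simp only [hL, HQuot]
    field_simp
  · have hGc : ContinuousOn G (Ioi w₀) := fun w hww =>
      (hG w (hw w hww)).2.2.continuousAt.continuousWithinAt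
    have hcL : ContinuousOn L (Ioi a) := fun s hs =>
      (hLd s (le_of_lt hs)).continuousAt.continuousWithinAt
    have hcH : ContinuousOn H (Ioi a) := fun s hs =>
      (hHd s (le_of_lt hs)).continuousAt.continuousWithinAt
    have hc1 : ContinuousOn (iteratedDeriv 1 H) (Ioi a) := fun s hs =>
      (hH' 1 (by norm_num) s (le_of_lt hs)).continuousAt.continuousWithinAt
    have hc2 : ContinuousOn (iteratedDeriv 2 H) (Ioi a) := fun s hs =>
      (hH' 2 (by norm_num) s (le_of_lt hs)).continuousAt.continuousWithinAt
    have hc3 : ContinuousOn (iteratedDeriv 3 H) (Ioi a) :=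
      ((hHdiff.iteratedDeriv_Ioi (n := 3) le_rfl).continuousOn).mono (Ioi_subset_Ioi has₀.le)
    have hN₃c : ContinuousOn N₃ (Ioi a) := by
      simp only [hN₃]
      fun_prop
    exact hN₃c.comp hGc fun w hww => (hG w (hw w hww)).1
  · intro w hww
    have h0 := (hG w (hw w hww)).1.le
    have := hL1 _ h0
    rw [hC']
    have : 0 ≤ (K * C + C) + (K * (K * C) + 3 * (K * C) + C * C + C) := by positivity
    linarith
  · intro w hww
    have h0 := (hG w (hw w hww)).1.le
    have e1 := hM (h1H _ h0) (hL1 _ h0)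
    have e2 := hL2 _ h0
    rw [abs_le] at e1 e2
    have : 0 ≤ C + (K * (K * C) + 3 * (K * C) + C * C + C) := by positivity
    simp only [hN₂]
    rw [abs_le]
    constructor <;> rw [hC'] <;> linarith
  · intro w hww
    have h0 := (hG w (hw w hww)).1.le
    have e1 := hM (h1H _ h0) (hM (h1H _ h0) (hL1 _ h0))
    have e2 := hM (h1H _ h0) (hL2 _ h0)
    have e3 := hM (hL1 _ h0) (hL1 _ h0)
    have e4 := hL3 _ h0
    rw [abs_le] at e1 e2 e3 e4
    have : 0 ≤ C + (K * C + C) := by positivity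
    simp only [hN₃]
    rw [abs_le]
    constructor <;> rw [hC'] <;> linarith

end Profile

/-! ### Asymptotics of the coefficients -/

theorem isBigO_log_of_tendsto_one {f e : ℝ → ℝ} {l : Filter ℝ} (hf : Tendsto f l (𝓝 1))
    (he : (fun x => f x - 1) =O[l] e) : (fun x => Real.log (f x)) =O[l] e := by
  have h1 := ((Real.hasDerivAt_log one_ne_zero).differentiableAt.isBigO_sub).comp_tendsto hf
  simp only [Real.log_one, sub_zero, Function.comp_def] at h1
  exact h1.trans he

namespace LogProfile

variable {g : ℝ → ℝ} {q : ℝ} (P : LogProfile g q)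

/-- `HQuot g` as a function of the values of `g`. -/
noncomputable def h (w : ℝ) : ℝ := HQuot g (P.G w)

/-- The logarithm of the ratio `g g' / (4 H)`, as a function of the values of `g`. In terms of
`w = g(u)` the radial equation reads `w'' = (h / w) (w' ^ 2 - exp (w - ρ + θ))`. -/
noncomputable def theta (w : ℝ) : ℝ :=
  Real.log w + Real.log (deriv g (P.G w)) - Real.log (4 * P.h w)

/-- The logarithmic derivative `w θ'`. -/
noncomputable def kappa (w : ℝ) : ℝ := 1 + P.h w - P.h₁ w / P.h w

/-- The logarithmic derivative `w κ'`. -/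
noncomputable def kappa₁ (w : ℝ) : ℝ := P.h₁ w - P.h₂ w / P.h w + P.h₁ w ^ 2 / P.h w ^ 2

/-- The second logarithmic derivative of `κ`. -/
noncomputable def kappa₂ (w : ℝ) : ℝ :=
  P.h₂ w - P.h₃ w / P.h w + 3 * P.h₁ w * P.h₂ w / P.h w ^ 2 - 2 * P.h₁ w ^ 3 / P.h w ^ 3

/-- The correction `w b' / b`, where `b = 1 + θ'`, of the coefficient `h` that makes the forcing
term of the shifted Hamiltonian system of order `w⁻²`. -/
noncomputable def delta (w : ℝ) : ℝ := (P.kappa₁ w - P.kappa w) / (w + P.kappa w)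

/-- The derivative of `delta`. -/
noncomputable def delta' (w : ℝ) : ℝ :=
  ((P.kappa₂ w - P.kappa₁ w) / w * (w + P.kappa w) -
    (P.kappa₁ w - P.kappa w) * (1 + P.kappa₁ w / w)) / (w + P.kappa w) ^ 2

/-- The forcing term of the shifted Hamiltonian system. -/
noncomputable def forcing (w : ℝ) : ℝ :=
  2 * (P.delta w / w) - (P.delta' w * P.h w - P.h₁ w / w * P.delta w) /
    (P.h w * (P.h w + P.delta w))

theorem tendsto_h' : Tendsto P.h atTop (𝓝 (1 / q)) := P.tendsto_h

theorem tendsto_h₁ : Tendsto P.h₁ atTop (𝓝 0) :=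
  tendsto_zero_of_log_deriv P.w₀_pos P.hasDerivAt_h P.hasDerivAt_h₁ P.abs_h₂_le P.tendsto_h

theorem isBigO_one_of_abs_le {f : ℝ → ℝ} {a C : ℝ} (hf : ∀ w > a, |f w| ≤ C) :
    f =O[atTop] (fun _ => (1 : ℝ)) := by
  refine IsBigO.of_bound C ?_
  filter_upwards [eventually_gt_atTop a] with w hw
  simpa using hf w hw

theorem tendsto_inv_h : Tendsto (fun w => (P.h w)⁻¹) atTop (𝓝 q) := by
  have := P.tendsto_h'.inv₀ (one_div_pos.2 P.q_pos).ne'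
  simpa using this

theorem isBigO_kappa : P.kappa =O[atTop] (fun _ => (1 : ℝ)) := by
  have h1 : Tendsto P.kappa atTop (𝓝 (1 + 1 / q - 0 * q)) := by
    have := (P.tendsto_h'.const_add 1).sub (P.tendsto_h₁.mul P.tendsto_inv_h)
    exact this
  exact h1.isBigO_one ℝ

theorem isBigO_kappa₁ : P.kappa₁ =O[atTop] (fun _ => (1 : ℝ)) := by
  have e1 := isBigO_one_of_abs_le P.abs_h₁_le
  have e2 := isBigO_one_of_abs_le P.abs_h₂_le
  have e0 : (fun w => (P.h w)⁻¹) =O[atTop] (fun _ => (1 : ℝ)) := P.tendsto_inv_h.isBigO_one ℝ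
  have e3 := e2.mul e0
  have e4 := (e1.mul e0).pow 2
  simp only [mul_one, one_pow] at e3 e4
  refine ((e1.sub e3).add e4).congr_left fun w => ?_
  simp only [kappa₁]
  ring

theorem isBigO_kappa₂ : P.kappa₂ =O[atTop] (fun _ => (1 : ℝ)) := by
  have e1 := isBigO_one_of_abs_le P.abs_h₁_le
  have e2 := isBigO_one_of_abs_le P.abs_h₂_le
  have e3 := isBigO_one_of_abs_le P.abs_h₃_le
  have e0 : (fun w => (P.h w)⁻¹) =O[atTop] (fun _ => (1 : ℝ)) := P.tendsto_inv_h.isBigO_one ℝ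
  have e4 := e3.mul e0
  have e5 := (e1.mul e0).mul (e2.mul e0)
  have e6 := (e1.mul e0).pow 3
  simp only [mul_one, one_pow] at e4 e5 e6
  refine (((e2.sub e4).add (e5.const_mul_left 3)).sub (e6.const_mul_left 2)).congr_left fun w => ?_
  simp only [kappa₂]
  ring

theorem isBigO_div_id {f : ℝ → ℝ} (hf : f =O[atTop] (fun _ => (1 : ℝ))) :
    (fun w => f w / w) =O[atTop] (fun w : ℝ => w⁻¹) := by
  simpa [div_eq_mul_inv] using hf.mul (isBigO_refl (fun w : ℝ => w⁻¹) atTop)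

theorem tendsto_zero_of_isBigO_inv {f : ℝ → ℝ} (hf : f =O[atTop] (fun w : ℝ => w⁻¹)) :
    Tendsto f atTop (𝓝 0) := hf.trans_tendsto tendsto_inv_atTop_zero

theorem tendsto_kappa_div : Tendsto (fun w => P.kappa w / w) atTop (𝓝 0) :=
  tendsto_zero_of_isBigO_inv (isBigO_div_id P.isBigO_kappa)

theorem isBigO_inv_add_kappa : (fun w => (w + P.kappa w)⁻¹) =O[atTop] (fun w : ℝ => w⁻¹) := by
  have h1 : Tendsto (fun w => (1 + P.kappa w / w)⁻¹) atTop (𝓝 (1 + 0)⁻¹) :=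
    (P.tendsto_kappa_div.const_add 1).inv₀ (by norm_num)
  have h2 := (h1.isBigO_one ℝ).mul (isBigO_refl (fun w : ℝ => w⁻¹) atTop)
  simp only [one_mul] at h2
  refine h2.congr' ?_ EventuallyEq.rfl
  filter_upwards [eventually_gt_atTop 0] with w hw
  rw [← mul_inv, one_add_mul, div_mul_cancel₀ _ hw.ne']

theorem isBigO_delta : P.delta =O[atTop] (fun w : ℝ => w⁻¹) := by
  have := (P.isBigO_kappa₁.sub P.isBigO_kappa).mul P.isBigO_inv_add_kappa
  simp only [one_mul] at this
  exact this

theorem isBigO_delta' : P.delta' =O[atTop] (fun w : ℝ => w⁻¹ * w⁻¹) := by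
  have e1 := (isBigO_div_id (P.isBigO_kappa₂.sub P.isBigO_kappa₁)).mul P.isBigO_inv_add_kappa
  have e2 : (fun w => 1 + P.kappa₁ w / w) =O[atTop] (fun _ => (1 : ℝ)) :=
    ((tendsto_zero_of_isBigO_inv (isBigO_div_id P.isBigO_kappa₁)).const_add 1).isBigO_one ℝ
  have e3 := ((P.isBigO_kappa₁.sub P.isBigO_kappa).mul e2).mul (P.isBigO_inv_add_kappa.pow 2)
  simp only [one_mul, sq] at e3
  have hw : ∀ᶠ w in atTop, w + P.kappa w ≠ 0 := by
    filter_upwards [P.tendsto_kappa_div.eventually_const_lt (show (-1 : ℝ) < 0 by norm_num),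
      eventually_gt_atTop 0] with w h1 h2
    rw [lt_div_iff₀ h2] at h1
    have : 0 < w + P.kappa w := by linarith
    exact this.ne'
  refine (e1.sub e3).congr' ?_ EventuallyEq.rfl
  filter_upwards [hw] with w hw
  simp only [delta']
  field_simp

theorem tendsto_delta : Tendsto P.delta atTop (𝓝 0) := tendsto_zero_of_isBigO_inv P.isBigO_delta

theorem isBigO_forcing : P.forcing =O[atTop] (fun w : ℝ => w⁻¹ * w⁻¹) := by
  have e0 : (fun w => (P.h w)⁻¹) =O[atTop] (fun _ => (1 : ℝ)) := P.tendsto_inv_h.isBigO_one ℝ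
  have e1 : (fun w => (P.h w + P.delta w)⁻¹) =O[atTop] (fun _ => (1 : ℝ)) :=
    ((P.tendsto_h'.add P.tendsto_delta).inv₀
      (by rw [add_zero]; exact (one_div_pos.2 P.q_pos).ne')).isBigO_one ℝ
  have e2 := P.tendsto_h'.isBigO_one ℝ
  have e3 := isBigO_div_id (isBigO_one_of_abs_le P.abs_h₁_le)
  have e4 : (fun w => P.delta w / w) =O[atTop] (fun w : ℝ => w⁻¹ * w⁻¹) := by
    simpa [div_eq_mul_inv] using P.isBigO_delta.mul (isBigO_refl (fun w : ℝ => w⁻¹) atTop)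
  have e5 := P.isBigO_delta'.mul e2
  simp only [mul_one] at e5
  have e6 := (e5.sub (e3.mul P.isBigO_delta)).mul (e0.mul e1)
  simp only [mul_one] at e6
  refine ((e4.const_mul_left 2).sub e6).congr_left fun w => ?_
  simp only [forcing, div_eq_mul_inv, mul_inv]

section Derivatives

variable {w : ℝ} (hw : P.w₀ < w)
include hw

theorem hasDerivAt_h' : HasDerivAt P.h (P.h₁ w / w) w := P.hasDerivAt_h w hw

theorem h_pos' : 0 < P.h w := P.h_pos w hw

theorem pos_of_gt : 0 < w := P.w₀_pos.trans hw

theorem hasDerivAt_theta : HasDerivAt P.theta (P.kappa w / w) w := by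
  have h0 := (P.pos_of_gt hw).ne'
  have h1 := (P.h_pos' hw).ne'
  have h2 := (P.deriv_pos w hw).ne'
  have e1 := (Real.hasDerivAt_log h0).add ((P.hasDerivAt_deriv w hw).log h2)
  have e2 := ((P.hasDerivAt_h' hw).const_mul 4).log (by positivity)
  refine (e1.sub e2).congr_deriv ?_
  simp only [kappa]
  rw [show HQuot g (P.G w) = P.h w from rfl]
  field_simp

theorem hasDerivAt_kappa : HasDerivAt P.kappa (P.kappa₁ w / w) w := by
  have h0 := (P.pos_of_gt hw).ne'
  have h1 := (P.h_pos' hw).ne'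
  have e := ((P.hasDerivAt_h' hw).const_add 1).sub
    ((P.hasDerivAt_h₁ w hw).div (P.hasDerivAt_h' hw) h1)
  refine e.congr_deriv ?_
  simp only [kappa₁]
  field_simp
  ring

theorem hasDerivAt_kappa₁ : HasDerivAt P.kappa₁ (P.kappa₂ w / w) w := by
  have h0 := (P.pos_of_gt hw).ne'
  have h1 := (P.h_pos' hw).ne'
  have e := ((P.hasDerivAt_h₁ w hw).sub ((P.hasDerivAt_h₂ w hw).div (P.hasDerivAt_h' hw) h1)).add
    (((P.hasDerivAt_h₁ w hw).pow 2).div ((P.hasDerivAt_h' hw).pow 2) (pow_ne_zero 2 h1))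
  refine e.congr_deriv ?_
  simp only [kappa₂, Pi.pow_apply]
  field_simp
  ring

theorem hasDerivAt_delta (hk : 0 < w + P.kappa w) : HasDerivAt P.delta (P.delta' w) w := by
  have h0 := (P.pos_of_gt hw).ne'
  have e := ((P.hasDerivAt_kappa₁ hw).sub (P.hasDerivAt_kappa hw)).div
    ((hasDerivAt_id w).add (P.hasDerivAt_kappa hw)) hk.ne'
  refine e.congr_deriv ?_
  simp only [delta', Pi.add_apply, id, Pi.sub_apply]
  congr 1
  ring

end Derivatives

theorem tendsto_id_add_kappa : Tendsto (fun w => w + P.kappa w) atTop atTop := by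
  obtain ⟨C, hC⟩ := P.isBigO_kappa.bound
  refine tendsto_atTop_mono' (f₁ := fun w => w + -C) atTop ?_
    (tendsto_atTop_add_const_right _ _ tendsto_id)
  filter_upwards [hC] with w hw
  rw [Real.norm_eq_abs, norm_one, mul_one] at hw
  linarith [(abs_le.1 hw).1]

/-- The weight of the energy has a derivative that tends to `q`, hence is increasing. -/
theorem tendsto_deriv_weight : Tendsto (fun w =>
    ((1 + P.kappa₁ w / w) * (P.h w + P.delta w) - (w + P.kappa w) * (P.h₁ w / w + P.delta' w)) /
      (P.h w + P.delta w) ^ 2) atTop (𝓝 q) := by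
  have h1 : Tendsto (fun w => 1 + P.kappa₁ w / w) atTop (𝓝 (1 + 0)) :=
    (tendsto_zero_of_isBigO_inv (isBigO_div_id P.isBigO_kappa₁)).const_add 1
  have h2 : Tendsto (fun w => P.h w + P.delta w) atTop (𝓝 (1 / q + 0)) :=
    P.tendsto_h'.add P.tendsto_delta
  have h3 : Tendsto (fun w => w * P.delta' w) atTop (𝓝 0) := by
    refine tendsto_zero_of_isBigO_inv ?_
    refine ((isBigO_refl (fun w : ℝ => w) atTop).mul P.isBigO_delta').congr' EventuallyEq.rfl ?_
    filter_upwards [eventually_gt_atTop 0] with w hw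
    field_simp
  have h4 : Tendsto (fun w => (1 + P.kappa w / w) * (P.h₁ w + w * P.delta' w)) atTop
      (𝓝 ((1 + 0) * (0 + 0))) :=
    (P.tendsto_kappa_div.const_add 1).mul (P.tendsto_h₁.add h3)
  have hq := P.q_pos.ne'
  have h5 := ((h1.mul h2).sub h4).div (h2.pow 2) (by
    rw [add_zero]; exact pow_ne_zero 2 (one_div_ne_zero hq))
  have e : ((1 + 0) * (1 / q + 0) - (1 + 0) * (0 + 0)) / (1 / q + 0) ^ 2 = q := by
    field_simp
    ring
  rw [e] at h5
  refine h5.congr' ?_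
  filter_upwards [eventually_gt_atTop 0] with w hw
  simp only [Pi.div_apply]
  congr 2
  field_simp

theorem isBigO_theta : P.theta =O[atTop] Real.log := by
  obtain ⟨K, hK⟩ := P.isBigO_kappa.bound
  obtain ⟨a, ha⟩ := eventually_atTop.1 (hK.and (eventually_gt_atTop (max P.w₀ 1)))
  have ha1 : 1 < a := (le_max_right _ _).trans_lt (ha a le_rfl).2
  have hw : ∀ w ≥ a, P.w₀ < w := fun w h => (le_max_left _ _).trans_lt (ha w h).2
  have hK' : ∀ w ≥ a, |P.kappa w| ≤ K := fun w h => by simpa using (ha w h).1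
  have hmono : ∀ σ : ℝ, |σ| = 1 → MonotoneOn (fun w => K * Real.log w - σ * P.theta w) (Ici a) := by
    intro σ hσ
    have hd : ∀ w ≥ a, HasDerivAt (fun w => K * Real.log w - σ * P.theta w)
        (K * w⁻¹ - σ * (P.kappa w / w)) w := fun w h =>
      ((Real.hasDerivAt_log (by linarith)).const_mul K).sub
        ((P.hasDerivAt_theta (hw w h)).const_mul σ)
    refine monotoneOn_of_hasDerivWithinAt_nonneg (convex_Ici a)
      (fun w h => (hd w h).continuousAt.continuousWithinAt)
      (fun w h => (hd w (interior_subset h)).hasDerivWithinAt) fun w h => ?_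
    have h : a ≤ w := interior_subset h
    have h0 : 0 < w := by linarith
    have h1 : σ * P.kappa w ≤ K := by
      refine (le_abs_self _).trans ?_
      rw [abs_mul, hσ, one_mul]
      exact hK' w h
    have h2 : K * w⁻¹ - σ * (P.kappa w / w) = (K - σ * P.kappa w) / w := by field_simp
    rw [h2]
    exact div_nonneg (by linarith) h0.le
  have hK0 : 0 ≤ K := (abs_nonneg _).trans (hK' a le_rfl)
  have hlog : ∀ᶠ w in atTop, |P.theta a| ≤ Real.log w :=
    Real.tendsto_log_atTop.eventually_ge_atTop _
  refine IsBigO.of_bound (K + 1) ?_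
  filter_upwards [hlog, eventually_ge_atTop a] with w h1 h2
  have h3 := hmono 1 (by simp) self_mem_Ici h2 h2
  have h4 := hmono (-1) (by simp) self_mem_Ici h2 h2
  simp only at h3 h4
  have h5 : 0 ≤ Real.log a := Real.log_nonneg ha1.le
  have h6 : 0 ≤ Real.log w := Real.log_nonneg (by linarith)
  have h7 : 0 ≤ K * Real.log a := by positivity
  have h8 := abs_le.1 h1
  rw [Real.norm_eq_abs, Real.norm_eq_abs, abs_of_nonneg h6, abs_le]
  constructor <;> linarith

end LogProfile

/-! ### The solution near the singularity -/

namespace LogProfile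

variable {g : ℝ → ℝ} {q : ℝ} (P : LogProfile g q)

/-- The phase-plane solution. Here `w = g(u)` is the independent variable, `z` is the logarithm of
`dw / dρ`, and `v = (w - ρ + θ) - 2 z`. -/
theorem exists_phase_solution : ∃ (a : ℝ) (z v : ℝ → ℝ), P.w₀ < a ∧
    (∀ w ≥ a, HasDerivAt z (-(P.h w / w * (Real.exp (v w) - 1))) w ∧
      HasDerivAt v (1 + P.kappa w / w - Real.exp (-z w) +
        2 * (P.h w / w) * (Real.exp (v w) - 1)) w) ∧
    (z =O[atTop] fun w : ℝ => w⁻¹) ∧ (v =O[atTop] fun w : ℝ => w⁻¹) := by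
  have hq := P.q_pos
  have hl : Tendsto (fun w => P.h w + P.delta w) atTop (𝓝 (1 / q)) := by
    simpa using P.tendsto_h'.add P.tendsto_delta
  have hkt : Tendsto (fun w => (w + P.kappa w) * (P.h w + P.delta w)⁻¹) atTop atTop := by
    refine P.tendsto_id_add_kappa.atTop_mul_pos hq ?_
    simpa using hl.inv₀ (one_div_pos.2 hq).ne'
  obtain ⟨M, hM⟩ := P.isBigO_forcing.bound
  obtain ⟨s₁, hs₁⟩ := eventually_atTop.1
    ((eventually_gt_atTop P.w₀).and ((P.tendsto_id_add_kappa.eventually_gt_atTop 0).and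
      ((hl.eventually_const_lt (one_div_pos.2 hq)).and ((hkt.eventually_ge_atTop 1).and
        ((P.tendsto_deriv_weight.eventually_const_lt hq).and hM)))))
  have hw₀ : ∀ w ≥ s₁, P.w₀ < w := fun w hw => (hs₁ w hw).1
  have hκ : ∀ w ≥ s₁, 0 < w + P.kappa w := fun w hw => (hs₁ w hw).2.1
  have hlpos : ∀ w ≥ s₁, 0 < P.h w + P.delta w := fun w hw => (hs₁ w hw).2.2.1
  have hw0 : ∀ w ≥ s₁, 0 < w := fun w hw => P.pos_of_gt (hw₀ w hw)
  have hδ : ∀ w ≥ s₁, HasDerivAt P.delta (P.delta' w) w := fun w hw =>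
    P.hasDerivAt_delta (hw₀ w hw) (hκ w hw)
  have hld : ∀ w ≥ s₁, HasDerivAt (fun w => P.h w + P.delta w) (P.h₁ w / w + P.delta' w) w :=
    fun w hw => (P.hasDerivAt_h' (hw₀ w hw)).add (hδ w hw)
  have hκd : ∀ w ≥ s₁, HasDerivAt (fun w => w + P.kappa w) (1 + P.kappa₁ w / w) w :=
    fun w hw => (hasDerivAt_id w).add (P.hasDerivAt_kappa (hw₀ w hw))
  have hcκ : ContinuousOn P.kappa (Ici s₁) := fun w hw =>
    (P.hasDerivAt_kappa (hw₀ w hw)).continuousAt.continuousWithinAt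
  have hcκ₁ : ContinuousOn P.kappa₁ (Ici s₁) := fun w hw =>
    (P.hasDerivAt_kappa₁ (hw₀ w hw)).continuousAt.continuousWithinAt
  have hch : ContinuousOn P.h (Ici s₁) := fun w hw =>
    (P.hasDerivAt_h' (hw₀ w hw)).continuousAt.continuousWithinAt
  have hch₁ : ContinuousOn P.h₁ (Ici s₁) := fun w hw =>
    (P.hasDerivAt_h₁ w (hw₀ w hw)).continuousAt.continuousWithinAt
  have hch₂ : ContinuousOn P.h₂ (Ici s₁) := fun w hw =>
    (P.hasDerivAt_h₂ w (hw₀ w hw)).continuousAt.continuousWithinAt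
  have hch₃ : ContinuousOn P.h₃ (Ici s₁) := P.continuousOn_h₃.mono hw₀
  have hcδ : ContinuousOn P.delta (Ici s₁) := fun w hw =>
    (hδ w hw).continuousAt.continuousWithinAt
  have hne0 : ∀ w ∈ Ici s₁, w ≠ 0 := fun w hw => (hw0 w hw).ne'
  have hneh : ∀ w ∈ Ici s₁, P.h w ≠ 0 := fun w hw => (P.h_pos' (hw₀ w hw)).ne'
  have hneκ : ∀ w ∈ Ici s₁, w + P.kappa w ≠ 0 := fun w hw => (hκ w hw).ne'
  have hnel : ∀ w ∈ Ici s₁, P.h w + P.delta w ≠ 0 := fun w hw => (hlpos w hw).ne'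
  have hcκ₂ : ContinuousOn P.kappa₂ (Ici s₁) := by
    unfold kappa₂
    exact ((hch₂.sub (hch₃.div hch hneh)).add (((hch₁.const_mul 3).mul hch₂).div (hch.pow 2)
      fun w hw => pow_ne_zero 2 (hneh w hw))).sub (((hch₁.pow 3).const_mul 2).div (hch.pow 3)
      fun w hw => pow_ne_zero 3 (hneh w hw))
  have hcid : ContinuousOn (fun w : ℝ => w) (Ici s₁) := continuousOn_id
  have hcδ' : ContinuousOn P.delta' (Ici s₁) := by
    unfold delta'
    exact ((((hcκ₂.sub hcκ₁).div hcid hne0).mul (hcid.add hcκ)).sub ((hcκ₁.sub hcκ).mul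
      ((hcκ₁.div hcid hne0).const_add 1))).div ((hcid.add hcκ).pow 2)
      fun w hw => pow_ne_zero 2 (hneκ w hw)
  have hcm : ContinuousOn P.forcing (Ici s₁) := by
    unfold forcing
    exact ((hcδ.div hcid hne0).const_mul 2).sub (((hcδ'.mul hch).sub
      ((hch₁.div hcid hne0).mul hcδ)).div (hch.mul (hch.add hcδ))
      fun w hw => mul_ne_zero (hneh w hw) (hnel w hw))
  obtain ⟨s₂, hs₂, D, Z, N, hZN⟩ := exists_decaying_solution (b := fun w => (w + P.kappa w) / w)
    (c := fun w => (P.h w + P.delta w) / w) (k := fun w => (w + P.kappa w) / (P.h w + P.delta w))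
    (m := P.forcing) (M := max M 0) (hw0 s₁ le_rfl) (le_max_right _ _)
    ((hcid.add hcκ).div hcid hne0) ((hch.add hcδ).div hcid hne0) hcm
    (fun w hw => div_pos (hlpos w hw) (hw0 w hw))
    (fun w hw => by
      have := hne0 w hw
      have := hnel w hw
      field_simp)
    (fun w hw => (hκd w hw).div (hld w hw) (hnel w hw))
    (fun w hw => (hs₁ w hw).2.2.2.2.1.le)
    (fun w hw => (hs₁ w hw).2.2.2.1)
    (fun w hw => by
      have h1 := (hs₁ w hw).2.2.2.2.2
      have h0 := hw0 w hw
      rw [Real.norm_eq_abs, Real.norm_eq_abs, abs_of_nonneg (by positivity : 0 ≤ w⁻¹ * w⁻¹)] at h1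
      have h2 : M * (w⁻¹ * w⁻¹) = M / w ^ 2 := by field_simp
      rw [h2] at h1
      refine h1.trans ?_
      gcongr
      exact le_max_left _ _)
  have hbig : ∀ f : ℝ → ℝ, (∀ w > s₂, |f w| ≤ D / w) → f =O[atTop] fun w : ℝ => w⁻¹ := by
    intro f hf
    refine IsBigO.of_bound D ?_
    filter_upwards [eventually_gt_atTop s₂] with w hw
    have h0 : 0 < w := hw0 w (hs₂.le.trans hw.le)
    rw [Real.norm_eq_abs, Real.norm_eq_abs, abs_of_nonneg (by positivity : 0 ≤ w⁻¹),
      ← div_eq_mul_inv]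
    exact hf w hw
  -- The equilibrium is `z₀ = -log (1 + θ')` and `v₀ = log ((h + δ) / h)`, so that `w z₀' = -δ`.
  refine ⟨s₂ + 1, fun w => Real.log w - Real.log (w + P.kappa w) + Z w,
    fun w => Real.log (P.h w + P.delta w) - Real.log (P.h w) + N w, ?_, ?_, ?_, ?_⟩
  · linarith [hw₀ s₁ le_rfl]
  · intro w hw
    have hws₂ : s₂ < w := by linarith
    have hws₁ : s₁ ≤ w := hs₂.le.trans hws₂.le
    obtain ⟨hZ, hN, -, -⟩ := hZN w hws₂
    have n0 := hw0 w hws₁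
    have nh := P.h_pos' (hw₀ w hws₁)
    have nκ := hκ w hws₁
    have nl := hlpos w hws₁
    have ez : Real.exp (-(Real.log w - Real.log (w + P.kappa w) + Z w)) =
        (w + P.kappa w) / w * Real.exp (-Z w) := by
      rw [neg_add, neg_sub, Real.exp_add, Real.exp_sub, Real.exp_log nκ, Real.exp_log n0]
    have ev : Real.exp (Real.log (P.h w + P.delta w) - Real.log (P.h w) + N w) =
        (P.h w + P.delta w) / P.h w * Real.exp (N w) := by
      rw [Real.exp_add, Real.exp_sub, Real.exp_log nl, Real.exp_log nh]
    constructor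
    · refine (((Real.hasDerivAt_log n0.ne').sub ((hκd w hws₁).log nκ.ne')).add hZ).congr_deriv ?_
      rw [ev]
      have hδe : P.delta w * (w + P.kappa w) = P.kappa₁ w - P.kappa w := by
        rw [delta, div_mul_cancel₀ _ nκ.ne']
      field_simp
      linear_combination hδe
    · refine ((((hld w hws₁).log nl.ne').sub ((P.hasDerivAt_h' (hw₀ w hws₁)).log nh.ne')).add
        hN).congr_deriv ?_
      rw [ev, ez, forcing]
      field_simp
      ring
  · have h1 : Tendsto (fun w => 1 + P.kappa w / w) atTop (𝓝 1) := by
      simpa using P.tendsto_kappa_div.const_add 1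
    have h2 := isBigO_log_of_tendsto_one (e := fun w : ℝ => w⁻¹) h1
      ((isBigO_div_id P.isBigO_kappa).congr_left fun w => by ring)
    refine IsBigO.add ?_ (hbig Z fun w hw => (hZN w hw).2.2.1)
    refine h2.neg_left.congr' ?_ EventuallyEq.rfl
    filter_upwards [eventually_ge_atTop s₁] with w hw
    have n0 := hw0 w hw
    rw [← neg_sub (Real.log (w + P.kappa w)), ← Real.log_div (hκ w hw).ne' n0.ne', add_div,
      div_self n0.ne']
  · have h1 : Tendsto (fun w => 1 + P.delta w * (P.h w)⁻¹) atTop (𝓝 1) := by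
      simpa using (P.tendsto_delta.mul P.tendsto_inv_h).const_add 1
    have h3 := P.isBigO_delta.mul (P.tendsto_inv_h.isBigO_one ℝ)
    simp only [mul_one] at h3
    have h2 := isBigO_log_of_tendsto_one (e := fun w : ℝ => w⁻¹) h1
      (h3.congr_left fun w => by ring)
    refine IsBigO.add ?_ (hbig N fun w hw => (hZN w hw).2.2.2)
    refine h2.congr' ?_ EventuallyEq.rfl
    filter_upwards [eventually_ge_atTop s₁] with w hw
    have nh := P.h_pos' (hw₀ w hw)
    rw [← Real.log_div (hlpos w hw).ne' nh.ne', add_div, div_self nh.ne', div_eq_mul_inv]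

/-- A solution `u` of `u'' = -exp (g(u) - ρ) / 4` near `ρ = ∞` that tends to infinity, with the
asymptotic expansion of `g(u)`. -/
theorem exists_singular_solution : ∃ (a : ℝ) (u p : ℝ → ℝ),
    (∀ ρ ≥ a, HasDerivAt u (p ρ) ρ ∧ HasDerivAt p (-(1 / 4) * Real.exp (g (u ρ) - ρ)) ρ ∧
      0 < u ρ ∧ 0 < p ρ) ∧ Tendsto u atTop atTop ∧
    (fun ρ => g (u ρ) - ρ + P.theta ρ) =O[atTop] fun ρ => Real.log ρ / ρ := by
  obtain ⟨a, z, v, ha, hd, hz, hv⟩ := P.exists_phase_solution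
  have hw₀ : ∀ w ≥ a, P.w₀ < w := fun w hw => ha.trans_le hw
  have hlogid : Real.log =o[atTop] (fun w : ℝ => w) := Real.isLittleO_log_id_atTop
  have hlogtop : ∀ᶠ w : ℝ in atTop, (1 : ℝ) ≤ Real.log w :=
    Real.tendsto_log_atTop.eventually_ge_atTop 1
  set y : ℝ → ℝ := fun w => v w + 2 * z w with hy
  have hyO : y =O[atTop] fun w : ℝ => w⁻¹ := hv.add (hz.const_mul_left 2)
  set R : ℝ → ℝ := fun w => w + P.theta w - y w with hR
  have hRd : ∀ w ≥ a, HasDerivAt R (Real.exp (-z w)) w := by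
    intro w hw
    refine (((hasDerivAt_id w).add (P.hasDerivAt_theta (hw₀ w hw))).sub
      ((hd w hw).2.add ((hd w hw).1.const_mul 2))).congr_deriv ?_
    ring
  -- `R w - w` is logarithmic
  have hRlog : (fun w => P.theta w - y w) =O[atTop] Real.log := by
    refine P.isBigO_theta.sub ?_
    refine (tendsto_zero_of_isBigO_inv hyO).isBigO_one ℝ |>.trans ?_
    refine IsBigO.of_bound 1 ?_
    filter_upwards [hlogtop] with w hw
    rw [norm_one, one_mul]
    exact hw.trans (le_abs_self _)
  obtain ⟨b, hb⟩ := eventually_atTop.1 ((hRlog.trans_isLittleO hlogid).bound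
    (show (0 : ℝ) < 1 / 2 by norm_num))
  have hRw : ∀ w, max b 0 ≤ w → w / 2 ≤ R w ∧ R w ≤ 2 * w := by
    intro w hw
    have h0 : 0 ≤ w := (le_max_right _ _).trans hw
    have h1 := hb w ((le_max_left _ _).trans hw)
    rw [Real.norm_eq_abs, Real.norm_eq_abs, abs_of_nonneg h0, abs_le] at h1
    simp only [hR]
    constructor <;> linarith
  have hRtop : Tendsto R atTop atTop := by
    refine tendsto_atTop_mono' atTop ?_ (tendsto_id.atTop_div_const (show (0 : ℝ) < 2 by norm_num))
    filter_upwards [eventually_ge_atTop (max b 0)] with w hw using (hRw w hw).1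
  obtain ⟨W, hW, -, hWtop⟩ := exists_inverse_of_hasDerivAt_pos hRd
    (fun w _ => Real.exp_pos (-z w)) hRtop
  refine ⟨R a + 1, fun ρ => P.G (W ρ), fun ρ => (deriv g (P.G (W ρ)))⁻¹ * Real.exp (z (W ρ)),
    ?_, P.tendsto_G.comp hWtop, ?_⟩
  · intro ρ hρ
    obtain ⟨h1, h2, h3⟩ := hW ρ (by linarith)
    have hww := hw₀ _ h1.le
    have n0 := P.pos_of_gt hww
    have nh := P.h_pos' hww
    have ng := P.deriv_pos _ hww
    have hWd : HasDerivAt W (Real.exp (z (W ρ))) ρ := by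
      refine h3.congr_deriv ?_
      rw [← Real.exp_neg, neg_neg]
    refine ⟨(P.hasDerivAt_G _ hww).comp ρ hWd, ?_, P.G_pos _ hww, by positivity⟩
    have e1 := ((P.hasDerivAt_deriv _ hww).comp ρ hWd).inv ng.ne'
    have e2 := ((hd _ h1.le).1.comp ρ hWd).exp
    refine (e1.mul e2).congr_deriv ?_
    -- `W - ρ = y - θ`, where `exp θ = W g' / (4 h)`
    have e3 : g (P.G (W ρ)) - ρ = y (W ρ) - P.theta (W ρ) := by
      rw [P.g_G _ hww]
      have : R (W ρ) = W ρ + P.theta (W ρ) - y (W ρ) := rfl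
      linarith
    have e4 : Real.exp (P.theta (W ρ)) = W ρ * deriv g (P.G (W ρ)) / (4 * P.h (W ρ)) := by
      rw [theta, Real.exp_sub, Real.exp_add, Real.exp_log n0, Real.exp_log ng,
        Real.exp_log (by positivity)]
    have e5 : Real.exp (y (W ρ)) = Real.exp (v (W ρ)) * Real.exp (z (W ρ)) ^ 2 := by
      rw [← Real.exp_nat_mul, ← Real.exp_add]
      simp [hy]
    rw [e3, Real.exp_sub, e4, e5]
    simp only [Function.comp, Pi.inv_apply]
    rw [show HQuot g (P.G (W ρ)) = P.h (W ρ) from rfl]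
    field_simp
    ring
  · -- `g(u) - ρ + θ(ρ) = y(W) - (θ(W) - θ(ρ))`, and `θ' = O(1/ρ)` between `ρ` and `W`
    obtain ⟨K, hK⟩ := P.isBigO_kappa.bound
    obtain ⟨c, hc⟩ := eventually_atTop.1 (hK.and (eventually_gt_atTop (max P.w₀ 0)))
    have hK0 : 0 ≤ K := (abs_nonneg (P.kappa c)).trans (by simpa using (hc c le_rfl).1)
    obtain ⟨Cy, hCy⟩ := hyO.bound
    obtain ⟨Cl, hCl⟩ := hRlog.bound
    have hbnd : ∀ᶠ ρ in atTop, ρ / 2 ≤ W ρ ∧ W ρ ≤ 2 * ρ := by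
      filter_upwards [hWtop.eventually_ge_atTop (max b 0), eventually_gt_atTop (R a)] with ρ h1 h2
      have h3 := hRw _ h1
      rw [(hW ρ h2).2.1] at h3
      constructor <;> linarith [h3.1, h3.2]
    refine IsBigO.of_bound (2 * |Cy| + 2 * K * (|Cl| * 2)) ?_
    filter_upwards [hbnd, hWtop.eventually hCy, hWtop.eventually hCl, hlogtop,
      eventually_gt_atTop (R a), eventually_gt_atTop 0, eventually_ge_atTop (2 * c),
      hWtop.eventually_ge_atTop 1, eventually_ge_atTop 2, hWtop.eventually_gt_atTop P.w₀]
      with ρ h1 h2 h3 h4 h5 h6 h7 h8 h9 h10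
    have hWe : R (W ρ) = ρ := (hW ρ h5).2.1
    have hWe' : P.theta (W ρ) - y (W ρ) = ρ - W ρ := by
      have : R (W ρ) = W ρ + P.theta (W ρ) - y (W ρ) := rfl
      linarith
    have hW0 : 0 < W ρ := by linarith
    have hlW : Real.log (W ρ) ≤ 2 * Real.log ρ := by
      have e1 : Real.log (W ρ) ≤ Real.log (2 * ρ) := Real.log_le_log hW0 h1.2
      rw [Real.log_mul (by norm_num) h6.ne'] at e1
      have e2 : Real.log 2 ≤ Real.log ρ := Real.log_le_log (by norm_num) h9
      linarith
    have hlW0 : 0 ≤ Real.log (W ρ) := Real.log_nonneg h8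
    rw [Real.norm_eq_abs, Real.norm_eq_abs, abs_of_nonneg (by positivity : 0 ≤ (W ρ)⁻¹)] at h2
    rw [hWe', Real.norm_eq_abs, Real.norm_eq_abs, abs_of_nonneg hlW0] at h3
    have hd1 : |W ρ - ρ| ≤ |Cl| * 2 * Real.log ρ := by
      rw [abs_sub_comm]
      refine h3.trans ((mul_le_mul_of_nonneg_right (le_abs_self Cl) hlW0).trans ?_)
      rw [mul_assoc]
      exact mul_le_mul_of_nonneg_left hlW (abs_nonneg _)
    have hd2 : |P.theta (W ρ) - P.theta ρ| ≤ 2 * K / ρ * |W ρ - ρ| := by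
      have := (convex_Ici (ρ / 2)).norm_image_sub_le_of_norm_hasDerivWithin_le (f := P.theta)
        (f' := fun w => P.kappa w / w) (C := 2 * K / ρ) (x := ρ) (y := W ρ)
        (fun w hw => (P.hasDerivAt_theta ((le_max_left _ _).trans_lt
          (hc w ((by linarith : c ≤ ρ / 2).trans hw)).2)).hasDerivWithinAt)
        (fun w hw => by
          have hw' : ρ / 2 ≤ w := hw
          have e1 := (hc w ((by linarith : c ≤ ρ / 2).trans hw)).1
          rw [norm_one, mul_one, Real.norm_eq_abs] at e1
          have e2 : 0 < w := by linarith
          rw [Real.norm_eq_abs, abs_div, abs_of_pos e2, div_le_div_iff₀ e2 h6]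
          nlinarith [abs_nonneg (P.kappa w)])
        (show ρ / 2 ≤ ρ by linarith) h1.1
      simpa [Real.norm_eq_abs] using this
    have hyW : |y (W ρ)| ≤ 2 * |Cy| * (Real.log ρ / ρ) := by
      have e1 : (W ρ)⁻¹ ≤ 2 / ρ := by
        rw [inv_le_comm₀ hW0 (by positivity), inv_div]
        exact h1.1
      have e2 : (2 : ℝ) / ρ ≤ 2 * (Real.log ρ / ρ) := by
        rw [mul_div_assoc']
        gcongr
        linarith
      refine h2.trans ((mul_le_mul_of_nonneg_right (le_abs_self Cy) (by positivity)).trans ?_)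
      calc |Cy| * (W ρ)⁻¹ ≤ |Cy| * (2 * (Real.log ρ / ρ)) := by gcongr; exact e1.trans e2
        _ = _ := by ring
    have hd3 : |P.theta (W ρ) - P.theta ρ| ≤ 2 * K * (|Cl| * 2) * (Real.log ρ / ρ) := by
      refine hd2.trans ((mul_le_mul_of_nonneg_left hd1 (by positivity)).trans (le_of_eq ?_))
      ring
    have e5 : g (P.G (W ρ)) - ρ + P.theta ρ = y (W ρ) - (P.theta (W ρ) - P.theta ρ) := by
      rw [P.g_G _ h10]
      linarith
    rw [e5, Real.norm_eq_abs, Real.norm_eq_abs, abs_of_nonneg (by positivity : 0 ≤ Real.log ρ / ρ),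
      add_mul]
    exact (abs_sub _ _).trans (add_le_add hyW hd3)

end LogProfile

/-! ### Continuation of radial solutions, and the Laplacian -/

/-- A one-sided linear growth bound on the negative axis bounds the potential from below. -/
theorem neg_le_integral_of_growth {F : ℝ → ℝ} {A : ℝ} (hF : Continuous F) (hA : 0 ≤ A)
    (hpos : ∀ s, 0 ≤ s → 0 ≤ F s) (hneg : ∀ s < 0, F s ≤ A * (1 + |s|)) (x : ℝ) :
    -(A * (1 + |x|) ^ 2) ≤ ∫ s in (0 : ℝ)..x, F s := by
  have h0 : 0 ≤ A * (1 + |x|) ^ 2 := by positivity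
  rcases le_or_gt 0 x with hx | hx
  · have : 0 ≤ ∫ s in (0 : ℝ)..x, F s :=
      intervalIntegral.integral_nonneg hx fun s hs => hpos s hs.1
    linarith
  · rw [intervalIntegral.integral_symm]
    have h1 : ∫ s in x..0, F s ≤ ∫ _ in x..0, A * (1 + |x|) := by
      refine intervalIntegral.integral_mono_on_of_le_Ioo hx.le (hF.intervalIntegrable _ _)
        (by simp) fun s hs => ?_
      refine (hneg s hs.2).trans ?_
      have : |s| ≤ |x| := by
        rw [abs_of_neg hs.2, abs_of_neg hx]
        linarith [hs.1]
      gcongr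
    rw [intervalIntegral.integral_const, smul_eq_mul, zero_sub] at h1
    have h2 : -x = |x| := (abs_of_neg hx).symm
    rw [h2] at h1
    have h3 : |x| * (A * (1 + |x|)) ≤ A * (1 + |x|) ^ 2 := by
      nlinarith [abs_nonneg x, mul_nonneg hA (abs_nonneg x)]
    linarith

/-- The projection of the real line to `[-R, R]`. -/
def clamp (R x : ℝ) : ℝ := max (-R) (min x R)

theorem lipschitzWith_clamp (R : ℝ) : LipschitzWith 1 (clamp R) :=
  (LipschitzWith.id.min_const R).const_max (-R)

theorem abs_clamp_le {R : ℝ} (hR : 0 ≤ R) (x : ℝ) : |clamp R x| ≤ R := by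
  unfold clamp
  rw [abs_le]
  exact ⟨le_max_left _ _, max_le (by linarith) (min_le_right _ _)⟩

theorem clamp_of_abs_le {R x : ℝ} (h : |x| ≤ R) : clamp R x = x := by
  have := abs_le.1 h
  unfold clamp
  grind

theorem abs_clamp_le_abs {R : ℝ} (hR : 0 ≤ R) (x : ℝ) : |clamp R x| ≤ |x| := by
  unfold clamp
  grind

/-- The radial equation in the variable `t = 2 log r`, as a first-order system. -/
noncomputable def radialField (F : ℝ → ℝ) (t : ℝ) (y : ℝ × ℝ) : ℝ × ℝ :=
  (y.2, -(1 / 4) * Real.exp t * F y.1)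

theorem lipschitzOnBounded_radialField {F : ℝ → ℝ} (hF : LocallyLipschitz F) :
    LipschitzOnBounded (radialField F) := by
  intro a b R
  obtain ⟨K, hK⟩ := (hF.locallyLipschitzOn (s := Metric.closedBall 0 R)
    ).exists_lipschitzOnWith_of_compact (isCompact_closedBall 0 R)
  refine ⟨⟨1 + Real.exp b * K, by positivity⟩, fun t ht => LipschitzOnWith.of_dist_le_mul
    fun y hy z hz => ?_⟩
  rw [mem_closedBall_zero_iff] at hy hz
  have h1 : |y.1 - z.1| ≤ dist y z := le_max_left _ _
  have h2 : |y.2 - z.2| ≤ dist y z := le_max_right _ _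
  have h3 : |F y.1 - F z.1| ≤ K * |y.1 - z.1| := by
    simpa [Real.dist_eq] using hK.dist_le_mul y.1
      (mem_closedBall_zero_iff.2 ((norm_fst_le y).trans hy)) z.1
      (mem_closedBall_zero_iff.2 ((norm_fst_le z).trans hz))
  have h4 : Real.exp t ≤ Real.exp b := Real.exp_le_exp.2 ht.2
  have h5 : 0 ≤ dist y z := dist_nonneg
  have h6 : |-(1 / 4) * Real.exp t * F y.1 - -(1 / 4) * Real.exp t * F z.1| ≤
      Real.exp b * (K * dist y z) := by
    have e : -(1 / 4) * Real.exp t * F y.1 - -(1 / 4) * Real.exp t * F z.1 =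
        -((1 / 4) * Real.exp t * (F y.1 - F z.1)) := by ring
    rw [e, abs_neg, abs_mul, abs_of_pos (by positivity)]
    have := Real.exp_pos t
    refine mul_le_mul (by linarith) (h3.trans ?_) (abs_nonneg _) (Real.exp_pos b).le
    gcongr
  rw [Prod.dist_eq (x := radialField F t y)]
  change max |_ - _| |_ - _| ≤ (1 + Real.exp b * K) * dist y z
  simp only [radialField]
  have h7 : 0 ≤ Real.exp b * (K * dist y z) := by positivity
  refine max_le ?_ ?_ <;> linarith

/-- Solutions of the radial equation exist up to any later time, if the nonlinearity is nonnegative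
on `[0, ∞)` and at most linear from above on the negative axis. The energy
`2 exp (-t) u' ^ 2 + ∫ F` decreases, which bounds `u'` linearly in terms of `u`. -/
theorem exists_radial_solution_Icc {F : ℝ → ℝ} {A : ℝ} (hF : LocallyLipschitz F) (hA : 0 ≤ A)
    (hpos : ∀ s, 0 ≤ s → 0 ≤ F s) (hneg : ∀ s < 0, F s ≤ A * (1 + |s|)) {t₁ T u₁ : ℝ} (p₁ : ℝ)
    (hT : t₁ ≤ T) (hu₁ : 0 ≤ u₁) :
    ∃ y : ℝ → ℝ × ℝ, y t₁ = (u₁, p₁) ∧ IsIntegralCurveOn y (radialField F) (Icc t₁ T) := by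
  set E₀ : ℝ := 2 * Real.exp (-t₁) * p₁ ^ 2 + ∫ s in (0 : ℝ)..u₁, F s with hE₀
  have hΦ₀ : 0 ≤ ∫ s in (0 : ℝ)..u₁, F s :=
    intervalIntegral.integral_nonneg hu₁ fun s hs => hpos s hs.1
  have hE₀0 : 0 ≤ E₀ := by positivity
  set C : ℝ := √(Real.exp T * (E₀ + A)) with hC
  have hC0 : 0 ≤ C := Real.sqrt_nonneg _
  set M : ℝ := gronwallBound |u₁| C C (T - t₁) + 1 with hM
  have hgr : ∀ t ∈ Icc t₁ T, gronwallBound |u₁| C C (t - t₁) ≤ M := fun t ht =>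
    (gronwallBound_mono (abs_nonneg _) hC0 hC0 (sub_le_sub_right ht.2 t₁)).trans (by linarith)
  have hu₁M : |u₁| ≤ M := by
    have := hgr t₁ ⟨le_rfl, hT⟩
    rwa [sub_self, gronwallBound_x0] at this
  have hM0 : 0 ≤ M := (abs_nonneg _).trans hu₁M
  have hMpos : 0 < M := by
    have := gronwallBound_mono (abs_nonneg u₁) hC0 hC0 (by linarith : (0 : ℝ) ≤ T - t₁)
    rw [gronwallBound_x0] at this
    have h := abs_nonneg u₁
    linarith
  -- The nonlinearity, truncated outside of `[-M, M]`.
  set Ft : ℝ → ℝ := fun s => F (clamp M s) with hFt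
  obtain ⟨K, hK⟩ := (hF.locallyLipschitzOn (s := Metric.closedBall 0 M)
    ).exists_lipschitzOnWith_of_compact (isCompact_closedBall 0 M)
  obtain ⟨L, hL⟩ := (isCompact_closedBall (0 : ℝ) M).exists_bound_of_continuousOn
    hF.continuous.continuousOn
  have hmem : ∀ s, clamp M s ∈ Metric.closedBall (0 : ℝ) M := fun s =>
    mem_closedBall_zero_iff.2 (abs_clamp_le hM0 s)
  have hFtL : ∀ s, |Ft s| ≤ L := fun s => hL _ (hmem s)
  have hL0 : 0 ≤ L := (abs_nonneg _).trans (hFtL 0)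
  have hFtlip : ∀ s r, |Ft s - Ft r| ≤ K * |s - r| := by
    intro s r
    have h1 := hK.dist_le_mul _ (hmem s) _ (hmem r)
    have h2 := (lipschitzWith_clamp M).dist_le_mul s r
    rw [NNReal.coe_one, one_mul, Real.dist_eq, Real.dist_eq] at h2
    rw [Real.dist_eq, Real.dist_eq] at h1
    exact h1.trans (by gcongr)
  have hFtc : Continuous Ft := hF.continuous.comp (lipschitzWith_clamp M).continuous
  have hFtpos : ∀ s, 0 ≤ s → 0 ≤ Ft s := fun s hs => hpos _ (by unfold clamp; grind)
  have hFtneg : ∀ s < 0, Ft s ≤ A * (1 + |s|) := by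
    intro s hs
    have h1 : clamp M s < 0 := by unfold clamp; grind
    refine (hneg _ h1).trans ?_
    have := abs_clamp_le_abs hM0 s
    gcongr
  set B : ℝ := |p₁| + 1 / 4 * Real.exp T * L * (T - t₁) with hB
  have hTt : 0 ≤ T - t₁ := by linarith
  have hB0 : 0 ≤ B := by positivity
  set v : ℝ → ℝ × ℝ → ℝ × ℝ := fun t y => (clamp B y.2, -(1 / 4) * Real.exp t * Ft y.1) with hv
  have hexp : ∀ t ∈ Icc t₁ T, Real.exp t ≤ Real.exp T := fun t ht => Real.exp_le_exp.2 ht.2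
  have hbound2 : ∀ t ∈ Icc t₁ T, ∀ s, |-(1 / 4) * Real.exp t * Ft s| ≤ 1 / 4 * Real.exp T * L := by
    intro t ht s
    have e : -(1 / 4) * Real.exp t * Ft s = -((1 / 4) * Real.exp t * Ft s) := by ring
    rw [e, abs_neg, abs_mul, abs_of_pos (by positivity)]
    have := hexp t ht
    exact mul_le_mul (by linarith) (hFtL s) (abs_nonneg _) (by positivity)
  obtain ⟨y, hyt₁, hy⟩ := exists_isIntegralCurveOn_Icc_of_bounded (v := v)
    (K := ⟨1 + Real.exp T * K, by positivity⟩) (C := B + 1 / 4 * Real.exp T * L)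
    (left_mem_Icc.2 hT) (fun t ht => LipschitzWith.of_dist_le_mul fun y z => by
      have h1 : |y.1 - z.1| ≤ dist y z := le_max_left _ _
      have h2 : |y.2 - z.2| ≤ dist y z := le_max_right _ _
      have h3 := hFtlip y.1 z.1
      have h4 := (lipschitzWith_clamp B).dist_le_mul y.2 z.2
      rw [NNReal.coe_one, one_mul, Real.dist_eq, Real.dist_eq] at h4
      have h5 : 0 ≤ dist y z := dist_nonneg
      have h6 : |-(1 / 4) * Real.exp t * Ft y.1 - -(1 / 4) * Real.exp t * Ft z.1| ≤
          Real.exp T * (K * dist y z) := by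
        have e : -(1 / 4) * Real.exp t * Ft y.1 - -(1 / 4) * Real.exp t * Ft z.1 =
            -((1 / 4) * Real.exp t * (Ft y.1 - Ft z.1)) := by ring
        rw [e, abs_neg, abs_mul, abs_of_pos (by positivity)]
        have := Real.exp_pos t
        have := hexp t ht
        refine mul_le_mul (by linarith) (h3.trans ?_) (abs_nonneg _) (Real.exp_pos T).le
        gcongr
      rw [Prod.dist_eq (x := v t y)]
      change max |_ - _| |_ - _| ≤ (1 + Real.exp T * K) * dist y z
      simp only [hv]
      have h7 : 0 ≤ Real.exp T * (K * dist y z) := by positivity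
      refine max_le ?_ ?_ <;> linarith)
    (fun t ht y => by
      rw [Prod.norm_def]
      have h1 := abs_clamp_le hB0 y.2
      have h2 := hbound2 t ht y.1
      have h3 : 0 ≤ 1 / 4 * Real.exp T * L := by positivity
      change max |_| |_| ≤ _
      simp only [hv]
      refine max_le ?_ ?_ <;> linarith)
    (fun y => by
      simp only [hv]
      fun_prop) (u₁, p₁)
  have hd1 : ∀ t ∈ Icc t₁ T, HasDerivWithinAt (fun t => (y t).1) (clamp B (y t).2) (Icc t₁ T) t :=
    fun t ht => (hy t ht).fst
  have hd2 : ∀ t ∈ Icc t₁ T, HasDerivWithinAt (fun t => (y t).2)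
      (-(1 / 4) * Real.exp t * Ft (y t).1) (Icc t₁ T) t := fun t ht => (hy t ht).snd
  have hpB : ∀ t ∈ Icc t₁ T, |(y t).2| ≤ B := by
    intro t ht
    have h1 := (convex_Icc t₁ T).norm_image_sub_le_of_norm_hasDerivWithin_le hd2
      (fun s hs => hbound2 s hs _) (left_mem_Icc.2 hT) ht
    rw [hyt₁, Real.norm_eq_abs, Real.norm_eq_abs, abs_of_nonneg (sub_nonneg.2 ht.1)] at h1
    have h2 : 1 / 4 * Real.exp T * L * (t - t₁) ≤ 1 / 4 * Real.exp T * L * (T - t₁) := by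
      have := ht.2
      gcongr
    have h3 := abs_sub_abs_le_abs_sub (y t).2 p₁
    simp only at h1
    rw [hB]
    linarith
  have hd1' : ∀ t ∈ Icc t₁ T, HasDerivWithinAt (fun t => (y t).1) (y t).2 (Icc t₁ T) t := by
    intro t ht
    have := hd1 t ht
    rwa [clamp_of_abs_le (hpB t ht)] at this
  set e : ℝ → ℝ := fun t => 2 * Real.exp (-t) * (y t).2 ^ 2 + ∫ s in (0 : ℝ)..(y t).1, Ft s with he
  have hed : ∀ t ∈ Icc t₁ T, HasDerivWithinAt e (-(2 * Real.exp (-t) * (y t).2 ^ 2))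
      (Icc t₁ T) t := by
    intro t ht
    have h1 : HasDerivAt (fun t : ℝ => 2 * Real.exp (-t)) (-(2 * Real.exp (-t))) t := by
      refine (((hasDerivAt_neg t).exp).const_mul 2).congr_deriv ?_
      ring
    have h2 : HasDerivAt (fun x => ∫ s in (0 : ℝ)..x, Ft s) (Ft (y t).1) (y t).1 :=
      (hFtc.integral_hasStrictDerivAt 0 _).hasDerivAt
    refine ((h1.hasDerivWithinAt.mul ((hd2 t ht).pow 2)).add
      (h2.comp_hasDerivWithinAt t (hd1' t ht))).congr_deriv ?_
    have h3 : Real.exp (-t) * Real.exp t = 1 := by rw [← Real.exp_add]; simp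
    simp only [Nat.cast_ofNat, Nat.add_one_sub_one, pow_one, Pi.pow_apply]
    linear_combination (-(y t).2 * Ft (y t).1) * h3
  have heanti : AntitoneOn e (Icc t₁ T) := by
    refine antitoneOn_of_hasDerivWithinAt_nonpos (convex_Icc _ _)
      (fun t ht => (hed t ht).continuousWithinAt)
      (fun t ht => (hed t (interior_subset ht)).mono interior_subset) fun t _ => ?_
    have : 0 ≤ 2 * Real.exp (-t) * (y t).2 ^ 2 := by positivity
    linarith
  have het₁ : e t₁ = E₀ := by
    simp only [he, hyt₁, hE₀]
    congr 1
    refine intervalIntegral.integral_congr fun s hs => ?_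
    rw [uIcc_of_le hu₁] at hs
    simp only [hFt]
    rw [clamp_of_abs_le]
    rw [abs_of_nonneg hs.1]
    exact hs.2.trans ((le_abs_self _).trans hu₁M)
  have hpu : ∀ t ∈ Icc t₁ T, |(y t).2| ≤ C * |(y t).1| + C := by
    intro t ht
    have h1 := heanti (left_mem_Icc.2 hT) ht ht.1
    rw [het₁] at h1
    have h2 := neg_le_integral_of_growth hFtc hA hFtpos hFtneg (y t).1
    simp only [he] at h1
    have h3 : 2 * Real.exp (-t) * (y t).2 ^ 2 ≤ (E₀ + A) * (1 + |(y t).1|) ^ 2 := by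
      have : E₀ ≤ E₀ * (1 + |(y t).1|) ^ 2 := by
        refine le_mul_of_one_le_right hE₀0 (one_le_pow₀ ?_)
        linarith [abs_nonneg (y t).1]
      linarith
    have h4 : (y t).2 ^ 2 ≤ Real.exp T * (E₀ + A) * (1 + |(y t).1|) ^ 2 := by
      have e1 : Real.exp t * Real.exp (-t) = 1 := by rw [← Real.exp_add]; simp
      calc (y t).2 ^ 2 ≤ Real.exp t * (2 * Real.exp (-t) * (y t).2 ^ 2) := by
            have : Real.exp t * (2 * Real.exp (-t) * (y t).2 ^ 2) = 2 * (y t).2 ^ 2 := by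
              linear_combination (2 * (y t).2 ^ 2) * e1
            rw [this]
            nlinarith [sq_nonneg (y t).2]
        _ ≤ Real.exp T * ((E₀ + A) * (1 + |(y t).1|) ^ 2) := by
            have := hexp t ht
            gcongr
        _ = _ := by ring
    have h5 : C * |(y t).1| + C = C * (1 + |(y t).1|) := by ring
    rw [h5]
    refine abs_le_of_sq_le_sq ?_ (by positivity)
    rw [mul_pow, hC, Real.sq_sqrt (by positivity)]
    exact h4
  have huM : ∀ t ∈ Icc t₁ T, |(y t).1| ≤ M := by
    intro t ht
    refine (norm_le_gronwallBound_of_norm_deriv_right_le (f := fun t => (y t).1)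
      (f' := fun t => (y t).2) (δ := |u₁|) (K := C) (ε := C)
      (fun t ht => (hd1' t ht).continuousWithinAt)
      (fun t ht => (hd1' t (Ico_subset_Icc_self ht)).mono_of_mem_nhdsWithin
        (Icc_mem_nhdsGE_of_mem ht)) ?_ (fun t ht => hpu t (Ico_subset_Icc_self ht)) t ht).trans
      (hgr t ht)
    rw [hyt₁, Real.norm_eq_abs]
  refine ⟨y, hyt₁, fun t ht => ?_⟩
  refine (hy t ht).congr_deriv ?_
  simp only [hv, hFt, radialField]
  rw [clamp_of_abs_le (hpB t ht), clamp_of_abs_le (huM t ht)]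

/-- Solutions of the radial equation exist globally to the right. -/
theorem exists_radial_solution_Ici {F : ℝ → ℝ} {A : ℝ} (hF : LocallyLipschitz F) (hA : 0 ≤ A)
    (hpos : ∀ s, 0 ≤ s → 0 ≤ F s) (hneg : ∀ s < 0, F s ≤ A * (1 + |s|)) (t₁ p₁ : ℝ) {u₁ : ℝ}
    (hu₁ : 0 ≤ u₁) :
    ∃ u p : ℝ → ℝ, u t₁ = u₁ ∧ p t₁ = p₁ ∧ ∀ t ≥ t₁, HasDerivWithinAt u (p t) (Ici t₁) t ∧
      HasDerivWithinAt p (-(1 / 4) * Real.exp t * F (u t)) (Ici t₁) t := by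
  obtain ⟨y, h1, h2⟩ := exists_isIntegralCurveOn_Ici (lipschitzOnBounded_radialField hF)
    (a := t₁) (x := (u₁, p₁)) fun T hT => exists_radial_solution_Icc hF hA hpos hneg p₁ hT hu₁
  exact ⟨fun t => (y t).1, fun t => (y t).2, by simp [h1], by simp [h1], fun t ht =>
    ⟨(h2 t ht).fst, (h2 t ht).snd⟩⟩

/-- A solution of the radial equation on a left half line continues to the whole line. -/
theorem exists_radial_continuation {F : ℝ → ℝ} {A : ℝ} (hF : LocallyLipschitz F) (hA : 0 ≤ A)
    (hpos : ∀ s, 0 ≤ s → 0 ≤ F s) (hneg : ∀ s < 0, F s ≤ A * (1 + |s|)) {t₁ : ℝ}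
    {u p : ℝ → ℝ} (hu₁ : 0 ≤ u t₁)
    (hu : ∀ t ≤ t₁, HasDerivAt u (p t) t ∧ HasDerivAt p (-(1 / 4) * Real.exp t * F (u t)) t) :
    ∃ v r : ℝ → ℝ, (∀ t ≤ t₁, v t = u t ∧ r t = p t) ∧
      ∀ t, HasDerivAt v (r t) t ∧ HasDerivAt r (-(1 / 4) * Real.exp t * F (v t)) t := by
  obtain ⟨u', p', h1, h2, h3⟩ := exists_radial_solution_Ici hF hA hpos hneg t₁ (p t₁) hu₁
  have hle : ∀ (a b : ℝ → ℝ), ∀ t ≤ t₁, (if t ≤ t₁ then a t else b t) = a t := fun a b t ht => by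
    simp [ht]
  have hge : ∀ (a b : ℝ → ℝ), a t₁ = b t₁ → ∀ t, t₁ ≤ t →
      (if t ≤ t₁ then a t else b t) = b t := by
    intro a b hab t ht
    rcases ht.eq_or_lt with rfl | ht
    · simp [hab]
    · simp [not_le.2 ht]
  refine ⟨fun t => if t ≤ t₁ then u t else u' t, fun t => if t ≤ t₁ then p t else p' t,
    fun t ht => ⟨hle _ _ t ht, hle _ _ t ht⟩, fun t => ⟨?_, ?_⟩⟩
  · refine hasDerivAt_ite_le (d := fun t => if t ≤ t₁ then p t else p' t)
      (fun t ht => ?_) (fun t ht => ?_) h1.symm t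
    · simp only [hle p p' t ht]
      exact (hu t ht).1.hasDerivWithinAt
    · simp only [hge p p' h2.symm t ht]
      exact (h3 t ht).1
  · refine hasDerivAt_ite_le
      (d := fun t => -(1 / 4) * Real.exp t * F (if t ≤ t₁ then u t else u' t))
      (fun t ht => ?_) (fun t ht => ?_) h2.symm t
    · simp only [hle u u' t ht]
      exact (hu t ht).2.hasDerivWithinAt
    · simp only [hge u u' h1.symm t ht]
      exact (h3 t ht).2

open scoped RealInnerProductSpace in
/-- The Laplacian in the plane of a function of `‖x‖ ^ 2`. -/
theorem laplacian_comp_norm_sq {φ φ₁ : ℝ → ℝ} {φ₂ : ℝ} (hφ : ∀ τ > 0, HasDerivAt φ (φ₁ τ) τ)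
    {x : EuclideanSpace ℝ (Fin 2)} (hx : x ≠ 0) (hφ₁ : HasDerivAt φ₁ φ₂ (‖x‖ ^ 2)) :
    Laplacian.laplacian (fun y : EuclideanSpace ℝ (Fin 2) => φ (‖y‖ ^ 2)) x =
      4 * φ₁ (‖x‖ ^ 2) + 4 * ‖x‖ ^ 2 * φ₂ := by
  have hsq : ∀ y : EuclideanSpace ℝ (Fin 2),
      HasFDerivAt (fun y : EuclideanSpace ℝ (Fin 2) => ‖y‖ ^ 2) (2 • innerSL ℝ y) y :=
    fun y => (hasStrictFDerivAt_norm_sq y).hasFDerivAt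
  have h1 : ∀ y : EuclideanSpace ℝ (Fin 2), y ≠ 0 →
      fderiv ℝ (fun y : EuclideanSpace ℝ (Fin 2) => φ (‖y‖ ^ 2)) y =
        (2 * φ₁ (‖y‖ ^ 2)) • innerSL ℝ y := by
    intro y hy
    have h := (hφ (‖y‖ ^ 2) (by positivity)).comp_hasFDerivAt y (hsq y)
    refine h.fderiv.trans ?_
    ext z
    simp
    ring
  have h2 : fderiv ℝ (fun y : EuclideanSpace ℝ (Fin 2) => φ (‖y‖ ^ 2)) =ᶠ[𝓝 x]
      fun y => (2 * φ₁ (‖y‖ ^ 2)) • innerSL ℝ y := by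
    filter_upwards [isOpen_ne.mem_nhds hx] with y hy using h1 y hy
  have h3 : HasFDerivAt (fun y : EuclideanSpace ℝ (Fin 2) => 2 * φ₁ (‖y‖ ^ 2))
      ((2 : ℝ) • (φ₂ • (2 • innerSL ℝ x))) x :=
    (hφ₁.comp_hasFDerivAt x (hsq x)).const_mul 2
  have h4 : HasFDerivAt (fun y : EuclideanSpace ℝ (Fin 2) => (2 * φ₁ (‖y‖ ^ 2)) • innerSL ℝ y)
      _ x := h3.smul ((innerSL ℝ : EuclideanSpace ℝ (Fin 2) →L[ℝ] _).hasFDerivAt (x := x))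
  have h5 : ∀ e : EuclideanSpace ℝ (Fin 2), iteratedFDeriv ℝ 2
      (fun y : EuclideanSpace ℝ (Fin 2) => φ (‖y‖ ^ 2)) x ![e, e] =
        2 * φ₁ (‖x‖ ^ 2) * ⟪e, e⟫ + 4 * φ₂ * ⟪x, e⟫ ^ 2 := by
    intro e
    have h6 : (innerSL ℝ : EuclideanSpace ℝ (Fin 2) →L[ℝ] _) e e = ⟪e, e⟫ := rfl
    rw [iteratedFDeriv_two_apply, h2.fderiv_eq, h4.fderiv]
    simp [h6]
    ring
  rw [InnerProductSpace.laplacian_eq_iteratedFDeriv_orthonormalBasis _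
    (EuclideanSpace.basisFun (Fin 2) ℝ)]
  simp only [h5, Fin.sum_univ_two]
  simp [EuclideanSpace.norm_sq_eq, Fin.sum_univ_two, PiLp.inner_apply]
  ring

/-- A solution `v` of the radial equation in the variable `t = 2 log r` gives a radial solution in
the punctured plane. -/
theorem isRadialSolutionOn_of_hasDerivAt {F v r : ℝ → ℝ} (hF : Continuous F)
    (hv : ∀ t, HasDerivAt v (r t) t ∧ HasDerivAt r (-(1 / 4) * Real.exp t * F (v t)) t) :
    IsRadialSolutionOn F (fun s => v (2 * Real.log s)) (Ioi 0) := by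
  have hvd : deriv v = r := funext fun t => (hv t).1.deriv
  have hrd : deriv r = fun t => -(1 / 4) * Real.exp t * F (v t) := funext fun t => (hv t).2.deriv
  have hvdiff : Differentiable ℝ v := fun t => (hv t).1.differentiableAt
  have hrdiff : Differentiable ℝ r := fun t => (hv t).2.differentiableAt
  have hvc : Continuous v := hvdiff.continuous
  have hr1 : ContDiff ℝ 1 r := by
    rw [contDiff_one_iff_deriv, hrd]
    exact ⟨hrdiff, by fun_prop⟩
  have hv2 : ContDiff ℝ 2 v := by
    rw [show (2 : WithTop ℕ∞) = 1 + 1 by norm_num, contDiff_succ_iff_deriv, hvd]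
    exact ⟨hvdiff, by simp, hr1⟩
  refine ⟨?_, fun x hx => ?_⟩
  · refine hv2.comp_contDiffOn (contDiffOn_const.mul ?_)
    exact Real.contDiffOn_log.mono fun s hs => (ne_of_gt hs : s ≠ 0)
  · have hx : 0 < ‖x‖ := hx
    have hx0 : x ≠ 0 := norm_pos_iff.1 hx
    have he : (fun y : EuclideanSpace ℝ (Fin 2) => v (2 * Real.log ‖y‖)) =
        fun y => v (Real.log (‖y‖ ^ 2)) := by
      ext y
      rw [Real.log_pow]
      norm_num
    have h1 : ∀ τ > 0, HasDerivAt (fun τ => v (Real.log τ)) (r (Real.log τ) * τ⁻¹) τ := fun τ hτ =>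
      (hv _).1.comp τ (Real.hasDerivAt_log (ne_of_gt hτ))
    have hτ : 0 < ‖x‖ ^ 2 := by positivity
    have h2 := ((hv (Real.log (‖x‖ ^ 2))).2.comp _ (Real.hasDerivAt_log hτ.ne')).mul
      (hasDerivAt_inv hτ.ne')
    rw [he, laplacian_comp_norm_sq h1 hx0 h2]
    have h3 : 2 * Real.log ‖x‖ = Real.log (‖x‖ ^ 2) := by
      rw [Real.log_pow]; norm_num
    simp only [Function.comp]
    rw [h3, Real.exp_log hτ]
    field_simp
    ring

/-! ### The singular solution on the punctured plane -/

/-- The extension of a `C¹` function on `[0, ∞)` by a constant is locally Lipschitz. -/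
theorem locallyLipschitz_comp_max {f : ℝ → ℝ} (hf : ContDiffOn ℝ 1 f (Ici 0)) :
    LocallyLipschitz fun s => f (max s 0) := by
  intro x
  obtain ⟨K, t, ht, hK⟩ := (hf (max x 0) (le_max_right x 0)).exists_lipschitzOnWith (convex_Ici 0)
  have hm : LipschitzWith 1 fun s : ℝ => max s 0 := LipschitzWith.id.max_const 0
  refine ⟨K, (fun s : ℝ => max s 0) ⁻¹' t, ?_, fun a ha b hb => ?_⟩
  · have h1 : Tendsto (fun s : ℝ => max s 0) (𝓝 x) (𝓝[Ici 0] (max x 0)) :=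
      tendsto_nhdsWithin_iff.2 ⟨hm.continuous.tendsto x, Eventually.of_forall fun s =>
        le_max_right s 0⟩
    exact h1 ht
  · refine (hK ha hb).trans ?_
    have := hm a b
    rw [ENNReal.coe_one, one_mul] at this
    gcongr

/-- For a nonnegative nonlinearity, a solution that decreases at one time and is positive before has
a first zero, by concavity. -/
theorem exists_first_zero {F v r : ℝ → ℝ} {t₁ : ℝ} (hF : ∀ s, 0 ≤ F s)
    (hv : ∀ t, HasDerivAt v (r t) t ∧ HasDerivAt r (-(1 / 4) * Real.exp t * F (v t)) t)
    (hr : ∀ t ≤ t₁, r t < 0) (hpos : ∀ t ≤ t₁, 0 < v t) :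
    ∃ t₀, v t₀ = 0 ∧ ∀ t < t₀, 0 < v t := by
  have hranti : Antitone r := antitone_of_hasDerivAt_nonpos (fun t => (hv t).2) fun t => by
    have := mul_nonneg (Real.exp_pos t).le (hF (v t))
    change -(1 / 4) * Real.exp t * F (v t) ≤ 0
    linarith
  have hrneg : ∀ t, r t < 0 := fun t => by
    rcases le_total t t₁ with h | h
    · exact hr t h
    · exact (hranti h).trans_lt (hr t₁ le_rfl)
  have hvanti : StrictAnti v := strictAnti_of_hasDerivAt_neg (fun t => (hv t).1) hrneg
  have hvc : Continuous v := continuous_iff_continuousAt.2 fun t => (hv t).1.continuousAt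
  have hr₁ := hrneg t₁
  have hv₁ := hpos t₁ le_rfl
  set T : ℝ := t₁ + v t₁ / -r t₁ with hT
  have hTt : t₁ ≤ T := by
    have : 0 < v t₁ / -r t₁ := div_pos hv₁ (by linarith)
    linarith
  have hvT : v T ≤ 0 := by
    have h1 := (convex_Icc t₁ T).image_sub_le_mul_sub_of_deriv_le (f := v) (C := r t₁)
      hvc.continuousOn (fun t _ => (hv t).1.differentiableAt.differentiableWithinAt)
      (fun t ht => by
        rw [(hv t).1.deriv]
        exact hranti (interior_subset ht).1) t₁ (left_mem_Icc.2 hTt) T (right_mem_Icc.2 hTt) hTt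
    have h2 : r t₁ * (T - t₁) = -v t₁ := by
      rw [hT]
      have := hr₁.ne
      field_simp
      ring
    linarith
  obtain ⟨t₀, -, ht₀⟩ := intermediate_value_Icc' hTt hvc.continuousOn ⟨hvT, hv₁.le⟩
  exact ⟨t₀, ht₀, fun t ht => ht₀ ▸ hvanti ht⟩

/-- In terms of `LogProfile.theta`, the first terms of the expansion are `ρ - θ(ρ)`. -/
theorem LogProfile.expansion_eq {g : ℝ → ℝ} {q : ℝ} (P : LogProfile g q) {ρ : ℝ} (hρ : P.w₀ < ρ) :
    ρ - 2 * Real.log ρ + Real.log (g (gInv g ρ) / deriv g (gInv g ρ)) + Real.log 4 - Real.log q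
      + Real.log (q * HQuot g (gInv g ρ)) = ρ - P.theta ρ := by
  have h1 := P.pos_of_gt hρ
  have h2 := P.h_pos' hρ
  have h3 := P.deriv_pos ρ hρ
  rw [P.gInv_eq ρ hρ, P.g_G ρ hρ, Real.log_div h1.ne' h3.ne',
    show HQuot g (P.G ρ) = P.h ρ from rfl, Real.log_mul P.q_pos.ne' h2.ne', LogProfile.theta,
    Real.log_mul (by norm_num) h2.ne']
  ring

theorem tendsto_neg_two_mul_log : Tendsto (fun r : ℝ => -2 * Real.log r) (𝓝[>] 0) atTop :=
  Real.tendsto_log_nhdsGT_zero.const_mul_atBot_of_neg (by norm_num)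

theorem isLittleO_log_div_rpow {ε : ℝ} (hε : 0 < ε) :
    (fun r : ℝ => Real.log (-2 * Real.log r) / (-2 * Real.log r)) =o[𝓝[>] 0]
      fun r : ℝ => (-Real.log r) ^ (-1 + ε) := by
  have h1 : (fun ρ : ℝ => Real.log ρ / ρ) =o[atTop] fun ρ : ℝ => ρ ^ (-1 + ε) := by
    have := (isLittleO_log_rpow_atTop hε).mul_isBigO (isBigO_refl (fun ρ : ℝ => ρ⁻¹) atTop)
    refine this.congr' (Eventually.of_forall fun ρ => (div_eq_mul_inv _ _).symm) ?_
    filter_upwards [eventually_gt_atTop 0] with ρ hρ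
    rw [add_comm, Real.rpow_add hρ, Real.rpow_neg_one]
  refine (h1.comp_tendsto tendsto_neg_two_mul_log).trans_isBigO ?_
  refine IsBigO.of_bound ((2 : ℝ) ^ (-1 + ε)) ?_
  filter_upwards [tendsto_neg_two_mul_log.eventually_gt_atTop 0] with r hr
  have h2 : 0 ≤ -Real.log r := by linarith
  have h3 : -2 * Real.log r = 2 * -Real.log r := by ring
  simp only [Function.comp]
  rw [h3, Real.mul_rpow (by norm_num) h2, norm_mul, Real.norm_of_nonneg (by positivity)]

/-- `f` is a `C¹` positive function on `[0, ∞)` (its values at negative numbers are never used),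
and `g = log f`. -/
theorem theorem1p1 (f g : ℝ → ℝ) (q : ℝ)
    (hf : ContDiffOn ℝ 1 f (Ici 0)) (hpos : ∀ s, 0 ≤ s → 0 < f s)
    (hg : ∀ s, 0 ≤ s → g s = Real.log (f s))
    (hq : q ≠ 0) (hG1 : CondG1 g q) (hG2 : CondG2 g)
    (ε : ℝ) (hε : ε ∈ Ioc (0 : ℝ) (1 / 2)) :
    ∃ (U : ℝ → ℝ) (r₀ : ℝ), 0 < r₀ ∧
      ContDiffOn ℝ 2 U (Ioc 0 r₀) ∧
      IsRadialSolutionOn f U (Ioo 0 r₀) ∧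
      Tendsto U (𝓝[>] 0) atTop ∧
      (fun r : ℝ => g (U r) -
          (-2 * Real.log r - 2 * Real.log (-2 * Real.log r)
            + Real.log (g (gInv g (-2 * Real.log r)) / deriv g (gInv g (-2 * Real.log r)))
            + Real.log 4 - Real.log q
            + Real.log (q * HQuot g (gInv g (-2 * Real.log r)))))
        =o[𝓝[>] 0] (fun r : ℝ => (-Real.log r) ^ (-1 + ε)) ∧
      (∀ r ∈ Ioo 0 r₀, 0 < U r) ∧ U r₀ = 0 ∧
      (∀ F : ℝ → ℝ, IsAdmissibleExtension f F →
        ∃ V : ℝ → ℝ, EqOn V U (Ioc 0 r₀) ∧ IsRadialSingularSolution F V) := by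
  have hgc : ContinuousOn g (Ici 0) :=
    (hf.continuousOn.log fun s hs => (hpos s hs).ne').congr hg
  obtain ⟨P⟩ := nonempty_logProfile hgc hq hG1 hG2
  obtain ⟨a, u, p, hup, hutop, hasymp⟩ := P.exists_singular_solution
  -- the constant extension of `f` to the negative axis
  set F₀ : ℝ → ℝ := fun s => f (max s 0) with hF₀
  have hF₀f : ∀ s, 0 ≤ s → F₀ s = f s := fun s hs => by simp [hF₀, max_eq_left hs]
  have hF₀pos : ∀ s, 0 < F₀ s := fun s => hpos _ (le_max_right s 0)
  have hF₀lip : LocallyLipschitz F₀ := locallyLipschitz_comp_max hf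
  have hexpg : ∀ s, 0 ≤ s → Real.exp (g s) = f s := fun s hs => by
    rw [hg s hs, Real.exp_log (hpos s hs)]
  have hF₀neg : ∀ s < 0, F₀ s ≤ f 0 * (1 + |s|) := fun s hs => by
    have h1 : F₀ s = f 0 := by simp [hF₀, max_eq_right hs.le]
    rw [h1]
    have := hpos 0 le_rfl
    nlinarith [abs_nonneg s]
  -- time reversal `t = -ρ`
  obtain ⟨v, r, hvu, hv⟩ := exists_radial_continuation (t₁ := -a) (u := fun t => u (-t))
    (p := fun t => -p (-t)) hF₀lip (hpos 0 le_rfl).le (fun s _ => (hF₀pos s).le) hF₀neg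
    (hup _ (by simp)).2.2.1.le (fun t ht => by
      obtain ⟨h1, h2, h3, -⟩ := hup (-t) (by linarith)
      have e1 := h1.comp t (hasDerivAt_neg t)
      have e2 := (h2.comp t (hasDerivAt_neg t)).neg
      refine ⟨e1.congr_deriv (by ring), e2.congr_deriv ?_⟩
      rw [hF₀f _ h3.le, ← hexpg _ h3.le, Real.exp_sub, Real.exp_neg]
      field_simp)
  have hvpos : ∀ t ≤ -a, 0 < v t := fun t ht => by
    rw [(hvu t ht).1]
    exact (hup (-t) (by linarith)).2.2.1
  obtain ⟨t₀, hvt₀, hvt₀pos⟩ := exists_first_zero (fun s => (hF₀pos s).le) hv (fun t ht => by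
    rw [(hvu t ht).2]
    have := (hup (-t) (by linarith)).2.2.2
    linarith) hvpos
  have hv0 : ∀ t ≤ t₀, 0 ≤ v t := fun t ht => by
    rcases ht.eq_or_lt with rfl | h
    · exact hvt₀.ge
    · exact (hvt₀pos t h).le
  set r₀ : ℝ := Real.exp (t₀ / 2) with hr₀
  have hr₀pos : 0 < r₀ := Real.exp_pos _
  have hlog : ∀ s, 0 < s → s < r₀ → 2 * Real.log s < t₀ := fun s hs hs' => by
    have := Real.log_lt_log hs hs'
    rw [hr₀, Real.log_exp] at this
    linarith
  have hlog' : ∀ s ∈ Ioc 0 r₀, 2 * Real.log s ≤ t₀ := fun s hs => by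
    have := Real.log_le_log hs.1 hs.2
    rw [hr₀, Real.log_exp] at this
    linarith
  have hU := isRadialSolutionOn_of_hasDerivAt hF₀lip.continuous hv
  have hUu : ∀ᶠ s in 𝓝[>] (0 : ℝ), v (2 * Real.log s) = u (-2 * Real.log s) := by
    filter_upwards [tendsto_neg_two_mul_log.eventually_ge_atTop a] with s hs
    rw [(hvu _ (by linarith)).1]
    ring_nf
  have hUtop : Tendsto (fun s => v (2 * Real.log s)) (𝓝[>] 0) atTop :=
    (hutop.comp tendsto_neg_two_mul_log).congr' (hUu.mono fun s hs => hs.symm)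
  refine ⟨fun s => v (2 * Real.log s), r₀, hr₀pos, hU.1.mono Ioc_subset_Ioi_self,
    ⟨hU.1.mono Ioo_subset_Ioi_self, fun x hx => ?_⟩, hUtop, ?_, fun s hs =>
    hvt₀pos _ (hlog s hs.1 hs.2), ?_, fun F hF => ?_⟩
  · rw [hU.2 x hx.1]
    exact hF₀f _ (hvt₀pos _ (hlog _ hx.1 hx.2)).le
  · refine IsBigO.trans_isLittleO ?_ (isLittleO_log_div_rpow hε.1)
    refine (hasymp.comp_tendsto tendsto_neg_two_mul_log).congr' ?_ EventuallyEq.rfl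
    filter_upwards [hUu, tendsto_neg_two_mul_log.eventually_gt_atTop P.w₀] with s hs hs'
    simp only [Function.comp]
    rw [hs, P.expansion_eq hs']
    ring
  · simp only [hr₀, Real.log_exp]
    rw [mul_div_cancel₀ t₀ two_ne_zero, hvt₀]
  · obtain ⟨hFlip, hFf, A, hA⟩ := hF
    have hFv : ∀ t ≤ t₀, F (v t) = F₀ (v t) := fun t ht => by
      rw [hFf (hv0 t ht), hF₀f _ (hv0 t ht)]
    obtain ⟨v', r', hv'v, hv'⟩ := exists_radial_continuation (t₁ := t₀) (u := v) (p := r)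
      (A := max A 0) hFlip (le_max_right _ _)
      (fun s hs => by
        rw [hFf hs]
        exact (hpos s hs).le)
      (fun s hs => (hA s hs).trans (by
        gcongr
        exact le_max_left _ _)) hvt₀.ge (fun t ht => by
        rw [hFv t ht]
        exact hv t)
    have hVU : EqOn (fun s => v' (2 * Real.log s)) (fun s => v (2 * Real.log s)) (Ioc 0 r₀) :=
      fun s hs => (hv'v _ (hlog' s hs)).1
    refine ⟨fun s => v' (2 * Real.log s), hVU,
      isRadialSolutionOn_of_hasDerivAt hFlip.continuous hv', hUtop.congr' ?_⟩
    filter_upwards [Ioc_mem_nhdsGT hr₀pos] with s hs using (hVU hs).symm
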